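/- **Theorem (Proximity decay for proportionally inconsistent vectors).** Let $M\ge 0$ and $N\ge 1$ be integers, $\delta>0$, $\epsilon_0>0$ and $0<\eta<1$. For $t\in\mathbb R$ let $\mathcal Q_\delta(t)=\delta\big(\lfloor t/\delta\rfloor+\tfrac12\big)$, applied componentwise to vectors. Let $\boldsymbol\Phi\in\mathbb R^{M\times N}$ have independent standard normal entries and let $\boldsymbol\xi\in\mathbb R^M$, independent of $\boldsymbol\Phi$, have independent entries uniform on $[0,\delta]$. Write $\|\cdot\|$ for the Euclidean norm, $\mathbb B^N=\{\boldsymbol x\in\mathbb R^N:\|\boldsymbol x\|\le 1\}$, and $\Sigma_K$ for the set of vectors of $\mathbb R^N$ with at most $K$ nonzero coordinates. Let $0<\rho<1$ be such that $$\bar\rho:=\rho\,\big(1+2\log(e/\rho)\big)<1,$$ and set $C_\rho:=\frac1{1-\bar\rho}$ and $D_\rho:=4\rho\,C_\rho\log(e/\rho)$. Then $C_\rho\ge 1$, $D_\rho\ge 4\rho$, and the following holds. (i) (Gaussian random frame coefficient quantization) Let $\mathcal K=\mathbb B^N$. If $$M\ \ge\ \frac{4\delta+4}{\epsilon_0}\Big(N\log\frac{29\sqrt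 N}{\epsilon_0}+\log\frac1{2\eta}\Big),$$ then, with probability at least $1-\eta$ over the draw of $(\boldsymbol\Phi,\boldsymbol\xi)$, $$\forall\,\boldsymbol x,\boldsymbol x^*\in\mathcal K:\quad \|\mathcal Q_\delta(\boldsymbol\Phi\boldsymbol x+\boldsymbol\xi)-\mathcal Q_\delta(\boldsymbol\Phi\boldsymbol x^*+\boldsymbol\xi)\|_1\le\rho\,\delta M\ \Longrightarrow\ \|\boldsymbol x-\boldsymbol x^*\|\le C_\rho\,\epsilon_0+D_\rho\,\delta .$$ (ii) (Quantized compressed sensing) Let $1\le K\le N$ be an integer and $\mathcal K=\Sigma_K\cap\mathbb B^N$. If $$M\ \ge\ \frac{4\delta+2}{\epsilon_0}\Big(2K\log\frac{56N}{\sqrt K\,\epsilon_0}+\log\frac1{2\eta}\Big),$$ then, with probability at least $1-\eta$ over the draw of $(\boldsymbol\Phi,\boldsymbol\xi)$, the same implication holds for all $\boldsymbol x,\boldsymbol x^*\in\mathcal K$. -/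

import Mathlib

noncomputable section

/-- The uniform midrise quantizer of resolution `δ`: `δ (⌊t / δ⌋ + 1/2)`. -/
def midriseQuantizer (δ t : ℝ) : ℝ := δ * ((⌊t / δ⌋ : ℝ) + 1 / 2)

/-- The dithered quantized projection `Q_δ (Φ x + ξ)`, with `Q_δ` applied componentwise. -/
def quantizedProjection {M N : ℕ} (δ : ℝ) (Φ : Fin M → Fin N → ℝ) (ξ : Fin M → ℝ)
    (x : EuclideanSpace ℝ (Fin N)) : Fin M → ℝ :=
  fun i => midriseQuantizer δ ((Matrix.of Φ).mulVec x.ofLp i + ξ i)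

/-- The `ℓ₁` distance of two vectors. -/
def l1Dist {M : ℕ} (u v : Fin M → ℝ) : ℝ := ∑ i, |u i - v i|

/-- The law of an `M × N` matrix (as its family of rows) with independent standard normal
entries. -/
def gaussianMatrixLaw (M N : ℕ) : MeasureTheory.Measure (Fin M → Fin N → ℝ) :=
  MeasureTheory.Measure.pi fun _ : Fin M =>
    MeasureTheory.Measure.pi fun _ : Fin N => ProbabilityTheory.gaussianReal 0 1

/-- The law of a vector of length `M` with independent entries uniform on `[0, δ]`
(Lebesgue measure conditioned on that interval). -/
def uniformDitherLaw (M : ℕ) (δ : ℝ) : MeasureTheory.Measure (Fin M → ℝ) :=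
  MeasureTheory.Measure.pi fun _ : Fin M =>
    ProbabilityTheory.cond MeasureTheory.volume (Set.Icc 0 δ)

/-- The joint law of the Gaussian matrix and of the independent dither. -/
def sensingLaw (M N : ℕ) (δ : ℝ) :
    MeasureTheory.Measure ((Fin M → Fin N → ℝ) × (Fin M → ℝ)) :=
  (gaussianMatrixLaw M N).prod (uniformDitherLaw M δ)

/-- The property `good` holds with probability at least `p`: it holds everywhere on some
measurable event of probability at least `p`. -/
def HoldsWithProbAtLeast {Ω : Type*} [MeasurableSpace Ω] (P : MeasureTheory.Measure Ω) (p : ℝ)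
    (good : Ω → Prop) : Prop :=
  ∃ E : Set Ω, MeasurableSet E ∧ ENNReal.ofReal p ≤ P E ∧ ∀ ω ∈ E, good ω

/-- The closed Euclidean unit ball of `ℝ^N`. -/
def unitBall (N : ℕ) : Set (EuclideanSpace ℝ (Fin N)) := {x | ‖x‖ ≤ 1}

/-- The vectors of `ℝ^N` with at most `K` nonzero coordinates. -/
def sparseVectors (N K : ℕ) : Set (EuclideanSpace ℝ (Fin N)) :=
  {x | (Finset.univ.filter fun j => x j ≠ 0).card ≤ K}

/-- `ρ̄ = ρ (1 + 2 log (e / ρ))`. -/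
def rhoBar (ρ : ℝ) : ℝ := ρ * (1 + 2 * Real.log (Real.exp 1 / ρ))

/-- `C_ρ = 1 / (1 - ρ̄)`. -/
def constC (ρ : ℝ) : ℝ := 1 / (1 - rhoBar ρ)

/-- `D_ρ = 4 ρ C_ρ log (e / ρ)`. -/
def constD (ρ : ℝ) : ℝ := 4 * ρ * constC ρ * Real.log (Real.exp 1 / ρ)

/-- Any two vectors of `S` whose quantized projections differ by at most `ρ δ M` in `ℓ₁` norm
are at Euclidean distance at most `C_ρ ε₀ + D_ρ δ`. -/
def ProximityOn {M N : ℕ} (δ ε₀ ρ : ℝ) (S : Set (EuclideanSpace ℝ (Fin N)))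
    (Φ : Fin M → Fin N → ℝ) (ξ : Fin M → ℝ) : Prop :=
  ∀ x ∈ S, ∀ x' ∈ S,
    l1Dist (quantizedProjection δ Φ ξ x) (quantizedProjection δ Φ ξ x') ≤ ρ * δ * (M : ℝ) →
      ‖x - x'‖ ≤ constC ρ * ε₀ + constD ρ * δ

end

/-! Put `ε = C_ρ ε₀ + D_ρ δ`. If `ε ≥ 2` nothing is to be proved in the unit ball. Otherwise take a
net of radius `r`, a small multiple of `ε`, divided by `√N` or `√K` when the dimension requires it.
Every row on which two quantized vectors differ costs at least `δ` in `ℓ₁`, so proportionally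
inconsistent vectors share their quantization cell on at least `M - ⌊ρM⌋` rows.

Let `x`, `y` be more than `ε` apart and lie near net points `p`, `q`. Sharing a cell on row `a`
forces no threshold to separate the projections of the two balls around `p` and `q`, an event
depending on `p`, `q` only (`mem_ambiguousRows`). Given `a`, the uniform dither makes its
probability at most `(1 - h/δ)₊` for a gap `h ≥ 0` between these projections, as for Buffon's needle
(`volume_floor_le_floor_le`). With `t = ε/δ`, the Gaussian average over `a` is controlled by moments
for small `t` (`integral_clippedGap_le_quadratic`) and by the bounded Gaussian density for large `t`
(`integral_clippedGap_le_inv`). Both are below `exp (-σ)`, with `σ = ε/(2δ+ε)` for the ball and `σ =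
2ε/(4δ+ε)` for sparse vectors.

Rows are independent, so a union bound over the sets of consistent rows and the pairs of net points
(`holdsWithProbAtLeast_of_net`) gives failure probability at most `(M choose ⌊ρM⌋) (n²/2) exp (-σ
(1-ρ) M)`. The binomial coefficient costs `ρ M log (e/ρ)` in the exponent; `C_ρ` and `D_ρ` are
chosen so that this cost is absorbed and `M ε₀` is left to pay for the net and for `η`
(`radius_mul_one_sub`). -/

open MeasureTheory ProbabilityTheory

/-! ### The clipped gap function -/

/-- The function `u ↦ min 1 (1 - u)₊`. -/
def clippedGap (u : ℝ) : ℝ := max 0 (min 1 (1 - u))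

theorem clippedGap_nonneg (u : ℝ) : 0 ≤ clippedGap u := le_max_left _ _

theorem clippedGap_le_one (u : ℝ) : clippedGap u ≤ 1 :=
  max_le zero_le_one (min_le_left _ _)

theorem clippedGap_antitone : Antitone clippedGap := fun u v h => by
  unfold clippedGap; gcongr

theorem continuous_clippedGap : Continuous clippedGap := by
  unfold clippedGap; fun_prop

theorem measurable_clippedGap : Measurable clippedGap := continuous_clippedGap.measurable

/-- The bound is the square `(1 - u/2)²`, hence nonnegative; its mean needs only two moments of `u`.
-/
theorem clippedGap_le_quadratic (u : ℝ) : clippedGap u ≤ 1 - u + u ^ 2 / 4 := by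
  unfold clippedGap
  refine max_le (by nlinarith [sq_nonneg (1 - u / 2)]) ?_
  rcases le_total u 0 with h | h
  · exact (min_le_left _ _).trans (by nlinarith)
  · exact (min_le_right _ _).trans (by nlinarith)

theorem integrable_clippedGap_comp {Ω : Type*} [MeasurableSpace Ω] {P : Measure Ω}
    [IsFiniteMeasure P] {f : Ω → ℝ} (hf : Measurable f) :
    Integrable (fun ω => clippedGap (f ω)) P :=
  Integrable.of_bound (measurable_clippedGap.comp hf).aestronglyMeasurable 1
    (ae_of_all _ fun ω => by
      rw [Real.norm_eq_abs, abs_of_nonneg (clippedGap_nonneg _)]; exact clippedGap_le_one _)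

/-! ### One-dimensional Gaussian integrals -/

theorem inv_sqrt_two_pi_le : (√(2 * Real.pi))⁻¹ ≤ 399 / 1000 := by
  rw [inv_le_comm₀ (by positivity) (by norm_num)]
  apply Real.le_sqrt_of_sq_le
  nlinarith [Real.pi_gt_d4]

theorem le_two_mul_inv_sqrt_two_pi : 797 / 1000 ≤ 2 * (√(2 * Real.pi))⁻¹ := by
  have h : (797 / 2000 : ℝ) ≤ (√(2 * Real.pi))⁻¹ := by
    rw [le_inv_comm₀ (by norm_num) (by positivity)]
    apply Real.sqrt_le_iff.2
    constructor
    · norm_num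
    · nlinarith [Real.pi_lt_d4]
  linarith

theorem gaussianPDFReal_zero_one (x : ℝ) :
    gaussianPDFReal 0 1 x = (√(2 * Real.pi))⁻¹ * Real.exp (-(1 / 2) * x ^ 2) := by
  rw [gaussianPDFReal_def]
  simp only [NNReal.coe_one, mul_one, sub_zero]
  congr 2; ring

theorem integral_abs_gaussianReal :
    ∫ x, |x| ∂(gaussianReal 0 1) = 2 * (√(2 * Real.pi))⁻¹ := by
  rw [integral_gaussianReal_eq_integral_smul one_ne_zero]
  have h1 : ∀ x : ℝ, gaussianPDFReal 0 1 x • |x| =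
      (fun y : ℝ => (√(2 * Real.pi))⁻¹ * (y * Real.exp (-(1 / 2) * y ^ 2))) |x| := by
    intro x
    rw [gaussianPDFReal_zero_one, smul_eq_mul]
    simp only [sq_abs]; ring
  simp_rw [h1]
  rw [integral_comp_abs (f := fun y : ℝ =>
    (√(2 * Real.pi))⁻¹ * (y * Real.exp (-(1 / 2) * y ^ 2))), integral_const_mul]
  have h2 := integral_rpow_mul_exp_neg_mul_rpow (p := 2) (q := 1) (b := 1 / 2) two_pos
    (by norm_num) (by norm_num)
  have h3 : ∫ x in Set.Ioi (0 : ℝ), x * Real.exp (-(1 / 2) * x ^ 2) = 1 := by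
    have h4 : (1 / 2 : ℝ) ^ (-((1 : ℝ) + 1) / 2) * (1 / 2) * Real.Gamma ((1 + 1) / 2) = 1 := by
      norm_num [Real.rpow_neg_one]
    rw [h4] at h2
    refine Eq.trans ?_ h2
    refine setIntegral_congr_fun measurableSet_Ioi fun x _ => ?_
    simp
  rw [h3, mul_one]

theorem integrable_max_zero_sub_mul_abs (A : ℝ) {B : ℝ} (hB : 0 < B) :
    Integrable fun x : ℝ => max 0 (A - B * |x|) := by
  refine Continuous.integrable_of_hasCompactSupport (by fun_prop) ?_
  refine HasCompactSupport.intro (K := Set.Icc (-(A / B)) (A / B)) isCompact_Icc fun x hx => ?_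
  have : A / B < |x| := by
    by_contra! h
    exact hx (abs_le.1 h)
  rw [div_lt_iff₀ hB] at this
  exact max_eq_left (by linarith)

theorem integral_max_zero_sub_mul_abs {A B : ℝ} (hA : 0 ≤ A) (hB : 0 < B) :
    ∫ x : ℝ, max 0 (A - B * |x|) = A ^ 2 / B := by
  rw [integral_comp_abs (f := fun x => max 0 (A - B * x))]
  have h0 : (0 : ℝ) ≤ A / B := by positivity
  have h1 : ∫ x in Set.Ioi (0 : ℝ), max 0 (A - B * x)
      = ∫ x in Set.Ioc (0 : ℝ) (A / B), (A - B * x) := by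
    rw [← integral_indicator measurableSet_Ioi, ← integral_indicator measurableSet_Ioc]
    congr 1
    ext x
    simp only [Set.indicator, Set.mem_Ioi, Set.mem_Ioc]
    by_cases hx : 0 < x
    · by_cases hx' : x ≤ A / B
      · have := (le_div_iff₀ hB).1 hx'
        simp only [hx, hx', and_self, if_true]
        exact max_eq_right (by linarith)
      · have := (div_lt_iff₀ hB).1 (not_le.1 hx')
        simp only [hx, hx', and_false, if_true, if_false]
        exact max_eq_left (by linarith)
    · simp [hx]
  rw [h1, ← intervalIntegral.integral_of_le h0, intervalIntegral.integral_sub (by simp)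
    (by apply Continuous.intervalIntegrable; fun_prop), intervalIntegral.integral_const_mul,
    integral_id, intervalIntegral.integral_const]
  simp only [smul_eq_mul]
  field_simp
  ring

/-- The Gaussian average of a trapezoid is at most its area times the maximal density. -/
theorem integral_clippedGap_mul_abs_le {z t w : ℝ} (hz : 0 ≤ z) (ht : 0 < t) (hw : 0 < w) :
    ∫ x, clippedGap (t * (w * |x| - z)) ∂(gaussianReal 0 1)
      ≤ 399 / 1000 * ((1 + 2 * t * z) / (t * w)) := by
  have hB : 0 < t * w := by positivity
  -- The trapezoid is a difference of two tents of area `A²/B`. As `(1 + tz)² - (tz)² = 1 + 2tz`,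
  -- the area is affine in `z`, so that a random `z` will enter through its mean only.
  have hF : ∀ x : ℝ, clippedGap (t * (w * |x| - z)) =
      max 0 ((1 + t * z) - t * w * |x|) - max 0 (t * z - t * w * |x|) := by
    intro x
    unfold clippedGap
    have e : 1 - t * (w * |x| - z) = 1 + t * z - t * w * |x| := by ring
    rw [e]
    rcases le_total 0 (t * z - t * w * |x|) with h | h
    · rw [min_eq_left (by linarith), max_eq_right h, max_eq_right (by linarith),
        max_eq_right (by linarith)]; ring
    · rw [min_eq_right (by linarith), max_eq_left h, sub_zero]
  have i1 := integrable_max_zero_sub_mul_abs (1 + t * z) hB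
  have i2 := integrable_max_zero_sub_mul_abs (t * z) hB
  have hI : ∫ x : ℝ, clippedGap (t * (w * |x| - z)) = (1 + 2 * t * z) / (t * w) := by
    simp_rw [hF]
    rw [integral_sub i1 i2, integral_max_zero_sub_mul_abs (by positivity) hB,
      integral_max_zero_sub_mul_abs (by positivity) hB]
    field_simp
    ring
  have hint : Integrable fun x : ℝ => clippedGap (t * (w * |x| - z)) := by
    simp_rw [hF]; exact i1.sub i2
  rw [integral_gaussianReal_eq_integral_smul one_ne_zero, ← hI, ← integral_const_mul]
  refine integral_mono_of_nonneg (ae_of_all _ fun x => ?_) (hint.const_mul _)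
    (ae_of_all _ fun x => ?_)
  · exact smul_nonneg (gaussianPDFReal_nonneg _ _ _) (clippedGap_nonneg _)
  · simp only [smul_eq_mul]
    refine mul_le_mul_of_nonneg_right ?_ (clippedGap_nonneg _)
    rw [gaussianPDFReal_zero_one]
    refine (mul_le_of_le_one_right (by positivity) ?_).trans inv_sqrt_two_pi_le
    exact Real.exp_le_one_iff.2 (by nlinarith [sq_nonneg x])

/-! ### Standard Gaussian vectors and their projections -/

section GaussianVector

variable {N : ℕ}

/-- The law of a vector with independent standard normal entries. -/
noncomputable abbrev gaussianVectorLaw (N : ℕ) : Measure (Fin N → ℝ) :=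
  Measure.pi fun _ : Fin N => gaussianReal 0 1

theorem hasGaussianLaw_gaussianVectorLaw :
    HasGaussianLaw (fun a : Fin N → ℝ => a) (gaussianVectorLaw N) := by
  have h : iIndepFun (fun (i : Fin N) (a : Fin N → ℝ) => id (a i)) (gaussianVectorLaw N) :=
    iIndepFun_pi (X := fun _ => id) (fun _ => aemeasurable_id)
  refine iIndepFun.hasGaussianLaw (X := fun (i : Fin N) (a : Fin N → ℝ) => a i) (fun i => ?_) h
  have hm := (measurePreserving_eval (fun _ : Fin N => gaussianReal 0 1) i).map_eq
  refine ⟨?_⟩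
  change IsGaussian (Measure.map (Function.eval i) (gaussianVectorLaw N))
  rw [hm]; infer_instance

theorem map_eval_gaussianVectorLaw (i : Fin N) :
    (gaussianVectorLaw N).map (fun a => a i) = gaussianReal 0 1 :=
  (measurePreserving_eval (fun _ : Fin N => gaussianReal 0 1) i).map_eq

theorem memLp_eval_gaussianVectorLaw (i : Fin N) :
    MemLp (fun a : Fin N → ℝ => a i) 2 (gaussianVectorLaw N) :=
  (hasGaussianLaw_gaussianVectorLaw.eval i).memLp_two

theorem integral_eval_gaussianVectorLaw (i : Fin N) :
    ∫ a : Fin N → ℝ, a i ∂(gaussianVectorLaw N) = 0 := by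
  have := integral_map (μ := gaussianVectorLaw N) (φ := fun a => a i) (f := fun x : ℝ => x)
    (measurable_pi_apply i).aemeasurable (by fun_prop)
  rw [← this, map_eval_gaussianVectorLaw, integral_id_gaussianReal]

theorem covariance_eval_gaussianVectorLaw (i j : Fin N) :
    cov[fun a : Fin N → ℝ => a i, fun a => a j; gaussianVectorLaw N] = if i = j then 1 else 0 := by
  split_ifs with h
  · subst h
    rw [covariance_self (measurable_pi_apply i).aemeasurable]
    have := variance_map (μ := gaussianVectorLaw N) (X := fun x : ℝ => x) (Y := fun a => a i)
      (by fun_prop) (measurable_pi_apply i).aemeasurable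
    rw [map_eval_gaussianVectorLaw] at this
    change Var[(fun x : ℝ => x) ∘ fun a => a i; gaussianVectorLaw N] = 1
    rw [← this, variance_fun_id_gaussianReal]; rfl
  · have hI : iIndepFun (fun (i : Fin N) (a : Fin N → ℝ) => id (a i)) (gaussianVectorLaw N) :=
      iIndepFun_pi (X := fun _ => id) (fun _ => aemeasurable_id)
    exact (hI.indepFun h).covariance_eq_zero (memLp_eval_gaussianVectorLaw i)
      (memLp_eval_gaussianVectorLaw j)

theorem memLp_dotProduct_gaussianVectorLaw (v : Fin N → ℝ) :
    MemLp (fun a : Fin N → ℝ => a ⬝ᵥ v) 2 (gaussianVectorLaw N) := by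
  unfold dotProduct
  exact memLp_finsetSum _ fun i _ => (memLp_eval_gaussianVectorLaw i).mul_const _

theorem covariance_dotProduct_gaussianVectorLaw (v w : Fin N → ℝ) :
    cov[fun a : Fin N → ℝ => a ⬝ᵥ v, fun a => a ⬝ᵥ w; gaussianVectorLaw N] = v ⬝ᵥ w := by
  unfold dotProduct
  rw [covariance_fun_sum_fun_sum (fun i => (memLp_eval_gaussianVectorLaw i).mul_const _)
    (fun i => (memLp_eval_gaussianVectorLaw i).mul_const _)]
  simp [covariance_mul_const_left, covariance_mul_const_right, covariance_eval_gaussianVectorLaw]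

theorem integral_dotProduct_gaussianVectorLaw (v : Fin N → ℝ) :
    ∫ a : Fin N → ℝ, a ⬝ᵥ v ∂(gaussianVectorLaw N) = 0 := by
  unfold dotProduct
  rw [integral_finsetSum _ fun i _ =>
    ((memLp_eval_gaussianVectorLaw i).integrable (by norm_num)).mul_const _]
  simp [integral_mul_const, integral_eval_gaussianVectorLaw]

theorem integral_dotProduct_sq_gaussianVectorLaw (v : Fin N → ℝ) :
    ∫ a : Fin N → ℝ, (a ⬝ᵥ v) ^ 2 ∂(gaussianVectorLaw N) = v ⬝ᵥ v := by
  rw [← covariance_dotProduct_gaussianVectorLaw, covariance_eq_sub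
    (memLp_dotProduct_gaussianVectorLaw v) (memLp_dotProduct_gaussianVectorLaw v),
    integral_dotProduct_gaussianVectorLaw]
  simp [sq]

theorem hasGaussianLaw_dotProduct (v : Fin N → ℝ) :
    HasGaussianLaw (fun a : Fin N → ℝ => a ⬝ᵥ v) (gaussianVectorLaw N) := by
  have := hasGaussianLaw_gaussianVectorLaw.map_fun
    (∑ i, v i • ContinuousLinearMap.proj (R := ℝ) (φ := fun _ : Fin N => ℝ) i)
  convert! this using 2 with a
  simp [dotProduct, mul_comm]

theorem map_dotProduct_gaussianVectorLaw {v : Fin N → ℝ} (hv : v ⬝ᵥ v = 1) :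
    (gaussianVectorLaw N).map (fun a => a ⬝ᵥ v) = gaussianReal 0 1 := by
  rw [(hasGaussianLaw_dotProduct v).map_eq_gaussianReal, integral_dotProduct_gaussianVectorLaw,
    ← covariance_self (hasGaussianLaw_dotProduct v).aemeasurable,
    covariance_dotProduct_gaussianVectorLaw, hv]
  simp

/-- For a unit vector `v`, the component of a Gaussian vector along `v` is independent of the
orthogonal component. -/
theorem indepFun_dotProduct_orthogonal {v : Fin N → ℝ} (hv : v ⬝ᵥ v = 1) :
    IndepFun (fun a : Fin N → ℝ => a ⬝ᵥ v) (fun a => a - (a ⬝ᵥ v) • v) (gaussianVectorLaw N) := by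
  -- The two parts are jointly Gaussian, so uncorrelated coordinates suffice: `v ⬝ᵥ (e_j - v_j v) =
  -- v_j - v_j = 0`.
  have h := HasGaussianLaw.indepFun_of_covariance_eval (P := gaussianVectorLaw N)
    (X := fun (_ : Unit) (a : Fin N → ℝ) => a ⬝ᵥ v)
    (Y := fun (j : Fin N) (a : Fin N → ℝ) => a ⬝ᵥ (Pi.single j 1 - v j • v)) ?_ ?_
  · have h' := h.comp (φ := fun f : Unit → ℝ => f ()) (ψ := fun f : Fin N → ℝ => f)
      (measurable_pi_apply (X := fun _ : Unit => ℝ) ()) measurable_id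
    convert! h' using 1
    ext a j
    simp [dotProduct_sub, mul_comm]
  · have := hasGaussianLaw_gaussianVectorLaw.map_fun
      ((ContinuousLinearMap.pi fun _ : Unit =>
        ∑ i, v i • ContinuousLinearMap.proj (R := ℝ) (φ := fun _ : Fin N => ℝ) i).prod
       (ContinuousLinearMap.pi fun j : Fin N =>
        ∑ i, (Pi.single j 1 - v j • v : Fin N → ℝ) i • ContinuousLinearMap.proj (R := ℝ)
          (φ := fun _ : Fin N => ℝ) i))
    convert! this using 2 with a
    ext j <;>
    simp [dotProduct, mul_comm]
  · intro _ j
    rw [covariance_dotProduct_gaussianVectorLaw]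
    simp [dotProduct_sub, hv]

end GaussianVector

/-! ### Restricted norms and the averaged row estimate -/

section RestrictedNorm

variable {N : ℕ}

/-- The Euclidean norm of the coordinates of `a` indexed by `T`. -/
noncomputable def normOn (T : Finset (Fin N)) (a : Fin N → ℝ) : ℝ := √(∑ j ∈ T, a j ^ 2)

theorem normOn_nonneg (T : Finset (Fin N)) (a : Fin N → ℝ) : 0 ≤ normOn T a := Real.sqrt_nonneg _

theorem normOn_sq (T : Finset (Fin N)) (a : Fin N → ℝ) : normOn T a ^ 2 = ∑ j ∈ T, a j ^ 2 :=
  Real.sq_sqrt (Finset.sum_nonneg fun _ _ => sq_nonneg _)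

theorem measurable_normOn (T : Finset (Fin N)) : Measurable (normOn T) := by
  unfold normOn; fun_prop

theorem normOn_eq_norm (T : Finset (Fin N)) (a : Fin N → ℝ) :
    normOn T a = ‖WithLp.toLp 2 (fun j : T => a j)‖ := by
  rw [EuclideanSpace.norm_eq, normOn, ← Finset.sum_coe_sort T]
  simp

theorem normOn_add_le (T : Finset (Fin N)) (a b : Fin N → ℝ) :
    normOn T (a + b) ≤ normOn T a + normOn T b := by
  simp only [normOn_eq_norm]
  exact norm_add_le (WithLp.toLp 2 (fun j : T => a j)) (WithLp.toLp 2 (fun j : T => b j))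

theorem normOn_smul (T : Finset (Fin N)) (c : ℝ) (a : Fin N → ℝ) :
    normOn T (c • a) = |c| * normOn T a := by
  simp only [normOn_eq_norm]
  exact norm_smul c (WithLp.toLp 2 (fun j : T => a j))

theorem normOn_le_sqrt_dotProduct (T : Finset (Fin N)) (v : Fin N → ℝ) :
    normOn T v ≤ √(v ⬝ᵥ v) := by
  refine Real.sqrt_le_sqrt ?_
  simp only [dotProduct, ← sq]
  exact Finset.sum_le_univ_sum_of_nonneg fun _ => sq_nonneg _

theorem normOn_le_abs_add (T : Finset (Fin N)) {v : Fin N → ℝ} (hv : v ⬝ᵥ v = 1)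
    (a : Fin N → ℝ) : normOn T a ≤ |a ⬝ᵥ v| + normOn T (a - (a ⬝ᵥ v) • v) := by
  have h := normOn_add_le T ((a ⬝ᵥ v) • v) (a - (a ⬝ᵥ v) • v)
  rw [add_sub_cancel, normOn_smul] at h
  have h1 := normOn_le_sqrt_dotProduct T v
  rw [hv, Real.sqrt_one] at h1
  nlinarith [abs_nonneg (a ⬝ᵥ v)]

theorem integrable_normOn_sq (T : Finset (Fin N)) :
    Integrable (fun a => normOn T a ^ 2) (gaussianVectorLaw N) := by
  simp_rw [normOn_sq]
  exact integrable_finsetSum _ fun i _ => (memLp_eval_gaussianVectorLaw i).integrable_sq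

theorem integral_normOn_sq (T : Finset (Fin N)) :
    ∫ a, normOn T a ^ 2 ∂(gaussianVectorLaw N) = T.card := by
  simp_rw [normOn_sq]
  rw [integral_finsetSum _ fun i _ => (memLp_eval_gaussianVectorLaw i).integrable_sq]
  have h (i : Fin N) : ∫ a : Fin N → ℝ, a i ^ 2 ∂(gaussianVectorLaw N) = 1 := by
    have := integral_dotProduct_sq_gaussianVectorLaw (Pi.single i (1 : ℝ))
    simpa using this
  simp [h]

theorem integrable_normOn_orthogonal_sq (T : Finset (Fin N)) (v : Fin N → ℝ) :
    Integrable (fun a => normOn T (a - (a ⬝ᵥ v) • v) ^ 2) (gaussianVectorLaw N) := by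
  simp_rw [normOn_sq]
  refine integrable_finsetSum _ fun i _ => MemLp.integrable_sq ?_
  exact (memLp_eval_gaussianVectorLaw i).sub
    ((memLp_dotProduct_gaussianVectorLaw v).mul_const (v i))

/-- The `j`-th coordinate of the orthogonal part has variance `1 - v_j² ≤ 1`. -/
theorem integral_normOn_orthogonal_sq_le (T : Finset (Fin N)) {v : Fin N → ℝ}
    (hv : v ⬝ᵥ v = 1) :
    ∫ a, normOn T (a - (a ⬝ᵥ v) • v) ^ 2 ∂(gaussianVectorLaw N) ≤ T.card := by
  simp_rw [normOn_sq]
  have hi (i : Fin N) : Integrable (fun a : Fin N → ℝ => (a - (a ⬝ᵥ v) • v) i ^ 2)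
      (gaussianVectorLaw N) :=
    MemLp.integrable_sq <| (memLp_eval_gaussianVectorLaw i).sub
      ((memLp_dotProduct_gaussianVectorLaw v).mul_const (v i))
  rw [integral_finsetSum _ fun i _ => hi i]
  refine (Finset.sum_le_card_nsmul T _ 1 fun j _ => ?_).trans (by simp)
  have e : ∀ a : Fin N → ℝ, (a - (a ⬝ᵥ v) • v) j = a ⬝ᵥ (Pi.single j 1 - v j • v) := fun a => by
    simp [dotProduct_sub, mul_comm]
  simp_rw [e]
  rw [integral_dotProduct_sq_gaussianVectorLaw]
  simp [sub_dotProduct, dotProduct_sub, hv]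
  nlinarith [sq_nonneg (v j)]

/-- A square-integrable function on a probability space has mean at most its quadratic mean. -/
theorem integral_le_of_integral_sq_le {Ω : Type*} [MeasurableSpace Ω] {P : Measure Ω}
    [IsProbabilityMeasure P] {f : Ω → ℝ} (hf : MemLp f 2 P) {b : ℝ} (hb : 0 ≤ b)
    (h : ∫ ω, f ω ^ 2 ∂P ≤ b ^ 2) : ∫ ω, f ω ∂P ≤ b := by
  have hv := variance_nonneg f P
  rw [variance_eq_sub hf] at hv
  simp only [Pi.pow_apply] at hv
  nlinarith [abs_le_of_sq_le_sq' (by linarith : (∫ ω, f ω ∂P) ^ 2 ≤ b ^ 2) hb]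

theorem memLp_normOn (T : Finset (Fin N)) : MemLp (normOn T) 2 (gaussianVectorLaw N) :=
  (memLp_two_iff_integrable_sq (measurable_normOn T).aestronglyMeasurable).2
    (integrable_normOn_sq T)

theorem measurable_orthogonal (v : Fin N → ℝ) :
    Measurable fun a : Fin N → ℝ => a - (a ⬝ᵥ v) • v := by
  unfold dotProduct; fun_prop

theorem memLp_normOn_orthogonal (T : Finset (Fin N)) (v : Fin N → ℝ) :
    MemLp (fun a => normOn T (a - (a ⬝ᵥ v) • v)) 2 (gaussianVectorLaw N) :=
  (memLp_two_iff_integrable_sq ((measurable_normOn T).comp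
    (measurable_orthogonal v)).aestronglyMeasurable).2 (integrable_normOn_orthogonal_sq T v)

variable {S T : Finset (Fin N)} {K : ℕ} {c t w : ℝ} {v : Fin N → ℝ}

/-- The estimate for small `t`: integrate `clippedGap_le_quadratic`, using `E |a ⬝ᵥ v| = √(2/π) ≥
0.797` and, by Cauchy-Schwarz, `E (normOn S a) ≤ √K`. -/
theorem integral_clippedGap_le_quadratic (hS : S.card ≤ K) (hT : T.card ≤ K) (hc : 0 ≤ c)
    (ht : 0 ≤ t) (hw : 0 ≤ w) (hv : v ⬝ᵥ v = 1) :
    ∫ a, clippedGap (t * (w * |a ⬝ᵥ v| - c * (normOn S a + normOn T a))) ∂(gaussianVectorLaw N)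
      ≤ 1 - t * (797 / 1000 * w - 2 * c * √K) + t ^ 2 * (w ^ 2 + (2 * c * √K) ^ 2) / 4 := by
  have hKS : (S.card : ℝ) ≤ K := by exact_mod_cast hS
  have hKT : (T.card : ℝ) ≤ K := by exact_mod_cast hT
  have hK : √(K : ℝ) ^ 2 = K := Real.sq_sqrt (Nat.cast_nonneg _)
  have mS := memLp_normOn S
  have mT := memLp_normOn T
  have eS : ∫ a, normOn S a ∂(gaussianVectorLaw N) ≤ √K :=
    integral_le_of_integral_sq_le mS (Real.sqrt_nonneg _) (by rw [integral_normOn_sq, hK]; exact hKS)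
  have eT : ∫ a, normOn T a ∂(gaussianVectorLaw N) ≤ √K :=
    integral_le_of_integral_sq_le mT (Real.sqrt_nonneg _) (by rw [integral_normOn_sq, hK]; exact hKT)
  have iS := mS.integrable (by norm_num : (1 : ENNReal) ≤ 2)
  have iT := mT.integrable (by norm_num : (1 : ENNReal) ≤ 2)
  have ig := ((memLp_dotProduct_gaussianVectorLaw v).integrable (by norm_num)).abs
  have ig2 := (memLp_dotProduct_gaussianVectorLaw v).integrable_sq
  have iS2 := integrable_normOn_sq S
  have iT2 := integrable_normOn_sq T
  have eg : ∫ a : Fin N → ℝ, |a ⬝ᵥ v| ∂(gaussianVectorLaw N) = 2 * (√(2 * Real.pi))⁻¹ := by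
    rw [← integral_abs_gaussianReal, ← map_dotProduct_gaussianVectorLaw hv, integral_map
      (hasGaussianLaw_dotProduct v).aemeasurable (by fun_prop)]
  have hle := le_two_mul_inv_sqrt_two_pi
  calc _ ≤ ∫ a, (1 - t * (w * |a ⬝ᵥ v| - c * (normOn S a + normOn T a))
        + t ^ 2 / 4 * (w ^ 2 * (a ⬝ᵥ v) ^ 2 + 2 * c ^ 2 * (normOn S a ^ 2 + normOn T a ^ 2)))
          ∂(gaussianVectorLaw N) := by
        refine integral_mono_of_nonneg (ae_of_all _ fun a => clippedGap_nonneg _) ?_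
          (ae_of_all _ fun a => (clippedGap_le_quadratic _).trans ?_)
        · exact ((integrable_const _).sub (((ig.const_mul _).sub
            ((iS.add iT).const_mul _)).const_mul _)).add
            (((ig2.const_mul _).add ((iS2.add iT2).const_mul _)).const_mul _)
        -- The cross term has a favourable sign and is dropped; `(s + s')² ≤ 2(s² + s'²)` handles
        -- the two norms.
        · have h1 : (w * |a ⬝ᵥ v| - c * (normOn S a + normOn T a)) ^ 2 ≤
              w ^ 2 * (a ⬝ᵥ v) ^ 2 + 2 * c ^ 2 * (normOn S a ^ 2 + normOn T a ^ 2) := by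
            have h2 : 0 ≤ w * |a ⬝ᵥ v| * (c * (normOn S a + normOn T a)) := by
              have := normOn_nonneg S a; have := normOn_nonneg T a; positivity
            have h3 : |a ⬝ᵥ v| ^ 2 = (a ⬝ᵥ v) ^ 2 := sq_abs _
            have h4 : 0 ≤ c ^ 2 * (normOn S a - normOn T a) ^ 2 := by positivity
            rw [← h3]
            nlinarith
          have h5 := mul_le_mul_of_nonneg_left h1 (by positivity : 0 ≤ t ^ 2 / 4)
          beta_reduce
          nlinarith
    _ = 1 - t * (w * (2 * (√(2 * Real.pi))⁻¹) - c * (∫ a, normOn S a ∂(gaussianVectorLaw N)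
          + ∫ a, normOn T a ∂(gaussianVectorLaw N)))
        + t ^ 2 / 4 * (w ^ 2 * 1 + 2 * c ^ 2 * (S.card + T.card)) := by
        rw [integral_add, integral_sub, integral_const_mul, integral_sub, integral_const_mul,
          integral_const_mul, integral_add iS iT, integral_const_mul, integral_add,
          integral_const_mul, integral_const_mul, integral_add iS2 iT2, integral_normOn_sq,
          integral_normOn_sq, eg, integral_dotProduct_sq_gaussianVectorLaw, hv]
        · simp
        · exact ig2.const_mul _
        · exact (iS2.add iT2).const_mul _
        · exact ig.const_mul _
        · exact (iS.add iT).const_mul _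
        · exact integrable_const _
        · exact ((ig.const_mul _).sub ((iS.add iT).const_mul _)).const_mul _
        · exact (integrable_const _).sub (((ig.const_mul _).sub
            ((iS.add iT).const_mul _)).const_mul _)
        · exact (((ig2.const_mul _).add ((iS2.add iT2).const_mul _)).const_mul _)
    _ ≤ _ := by
        have h1 := mul_le_mul_of_nonneg_left hle hw
        have h2 := mul_le_mul_of_nonneg_left (add_le_add eS eT) hc
        have h3 := mul_le_mul_of_nonneg_left (sub_le_sub h1 h2) ht
        have h4 : t ^ 2 / 4 * (w ^ 2 * 1 + 2 * c ^ 2 * (S.card + T.card))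
            ≤ t ^ 2 / 4 * (w ^ 2 * 1 + 2 * c ^ 2 * (K + K)) := by gcongr
        have h5 : (2 * c * √K) ^ 2 = 4 * c ^ 2 * K := by rw [mul_pow, hK]; ring
        rw [h5]
        nlinarith

/-- The estimate for large `t`, where the quadratic bound is useless. The norms depend on `a ⬝ᵥ v`;
splitting `a` along `v` bounds each by `|a ⬝ᵥ v|` plus an independent term, which turns `w` into `w
- 2c`. Conditionally on the orthogonal part the trapezoid estimate applies, and its bound is affine
in that part. -/
theorem integral_clippedGap_le_inv (hS : S.card ≤ K) (hT : T.card ≤ K) (hc : 0 ≤ c)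
    (ht : 0 < t) (hw : 2 * c < w) (hv : v ⬝ᵥ v = 1) :
    ∫ a, clippedGap (t * (w * |a ⬝ᵥ v| - c * (normOn S a + normOn T a))) ∂(gaussianVectorLaw N)
      ≤ 399 / 1000 * ((1 + 2 * t * (2 * c * √K)) / (t * (w - 2 * c))) := by
  have hKS : (S.card : ℝ) ≤ K := by exact_mod_cast hS
  have hKT : (T.card : ℝ) ≤ K := by exact_mod_cast hT
  have hK : √(K : ℝ) ^ 2 = K := Real.sq_sqrt (Nat.cast_nonneg _)
  have hw' : 0 < w - 2 * c := by linarith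
  set μ := gaussianVectorLaw N
  let b : (Fin N → ℝ) → (Fin N → ℝ) := fun a => a - (a ⬝ᵥ v) • v
  let g : (Fin N → ℝ) → ℝ := fun a => a ⬝ᵥ v
  have hb : Measurable b := measurable_orthogonal v
  have hg : Measurable g := by unfold g dotProduct; fun_prop
  let Z : (Fin N → ℝ) → ℝ := fun y => c * (normOn S y + normOn T y)
  have hZ0 : ∀ y, 0 ≤ Z y := fun y =>
    mul_nonneg hc (add_nonneg (normOn_nonneg _ _) (normOn_nonneg _ _))
  have hZ : Measurable Z := ((measurable_normOn S).add (measurable_normOn T)).const_mul c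
  have mS : MemLp (fun a => normOn S (b a)) 2 μ := memLp_normOn_orthogonal S v
  have mT : MemLp (fun a => normOn T (b a)) 2 μ := memLp_normOn_orthogonal T v
  have iS := mS.integrable (by norm_num : (1 : ENNReal) ≤ 2)
  have iT := mT.integrable (by norm_num : (1 : ENNReal) ≤ 2)
  have eS : ∫ a, normOn S (b a) ∂μ ≤ √K :=
    integral_le_of_integral_sq_le mS (Real.sqrt_nonneg _)
      (by rw [hK]; exact (integral_normOn_orthogonal_sq_le S hv).trans hKS)
  have eT : ∫ a, normOn T (b a) ∂μ ≤ √K :=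
    integral_le_of_integral_sq_le mT (Real.sqrt_nonneg _)
      (by rw [hK]; exact (integral_normOn_orthogonal_sq_le T hv).trans hKT)
  have iZ : Integrable (fun a => Z (b a)) μ := (iS.add iT).const_mul c
  have eZ : ∫ a, Z (b a) ∂μ ≤ 2 * c * √K := by
    unfold Z
    rw [integral_const_mul, integral_add iS iT]
    nlinarith [mul_le_mul_of_nonneg_left (add_le_add eS eT) hc]
  have hind : IndepFun g b μ := indepFun_dotProduct_orthogonal hv
  have hmap : μ.map (fun a => (g a, b a)) = (gaussianReal 0 1).prod (μ.map b) := by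
    rw [(indepFun_iff_map_prod_eq_prod_map_map hg.aemeasurable hb.aemeasurable).1 hind,
      map_dotProduct_gaussianVectorLaw hv]
  have : IsProbabilityMeasure (μ.map b) := Measure.isProbabilityMeasure_map hb.aemeasurable
  let G : ℝ × (Fin N → ℝ) → ℝ := fun p => clippedGap (t * ((w - 2 * c) * |p.1| - Z p.2))
  have hGm : Measurable fun p : ℝ × (Fin N → ℝ) => t * ((w - 2 * c) * |p.1| - Z p.2) := by
    fun_prop
  calc _ ≤ ∫ a, G (g a, b a) ∂μ := by
        refine integral_mono_of_nonneg (ae_of_all _ fun a => clippedGap_nonneg _)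
          (integrable_clippedGap_comp (hGm.comp (hg.prodMk hb)))
          (ae_of_all _ fun a => clippedGap_antitone ?_)
        refine mul_le_mul_of_nonneg_left ?_ ht.le
        have h1 := normOn_le_abs_add S hv a
        have h2 := normOn_le_abs_add T hv a
        have := mul_le_mul_of_nonneg_left (add_le_add h1 h2) hc
        simp only [Z, g, b]
        nlinarith
    _ = ∫ p, G p ∂((gaussianReal 0 1).prod (μ.map b)) := by
        have hG : Measurable G := measurable_clippedGap.comp hGm
        rw [← hmap, integral_map (hg.prodMk hb).aemeasurable hG.aestronglyMeasurable]
    _ = ∫ y, ∫ x, G (x, y) ∂(gaussianReal 0 1) ∂(μ.map b) :=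
        integral_prod_symm _ (integrable_clippedGap_comp hGm)
    _ ≤ ∫ y, 399 / 1000 * ((1 + 2 * t * Z y) / (t * (w - 2 * c))) ∂(μ.map b) := by
        refine integral_mono_of_nonneg (ae_of_all _ fun y => integral_nonneg fun x =>
          clippedGap_nonneg _) ?_ (ae_of_all _ fun y => integral_clippedGap_mul_abs_le (hZ0 y) ht hw')
        refine (integrable_map_measure (by fun_prop) hb.aemeasurable).2 ?_
        exact (((integrable_const _).add (iZ.const_mul _)).div_const _).const_mul _
    _ = 399 / 1000 * ((1 + 2 * t * ∫ a, Z (b a) ∂μ) / (t * (w - 2 * c))) := by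
        rw [integral_map hb.aemeasurable (by fun_prop), integral_const_mul, integral_div,
          integral_add (integrable_const _) (iZ.const_mul _), integral_const_mul]
        simp
    _ ≤ _ := by gcongr

end RestrictedNorm

/-! ### Numerical comparison with exponentials -/

section Numerics

variable {N K : ℕ} {S T : Finset (Fin N)} {c t w : ℝ} {v : Fin N → ℝ}

/-- Here `t` stands for `ε/δ` and `c` for `r/ε`. The value `w = 1 - 0.1245` is the least relative
distance left between net points, and `11/10` is where the quadratic and inverse bounds change over.
-/
theorem integral_clippedGap_le_exp_coarse (hS : S.card ≤ K) (hT : T.card ≤ K) (hc : 0 ≤ c)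
    (ht : 0 < t) (hc₁ : 2 * c ≤ 1245 / 10000) (hcK : 2 * c * √K ≤ 176 / 1000)
    (hw : w = 8755 / 10000) (hv : v ⬝ᵥ v = 1) :
    ∫ a, clippedGap (t * (w * |a ⬝ᵥ v| - c * (normOn S a + normOn T a))) ∂(gaussianVectorLaw N)
      ≤ Real.exp (-(t / (2 + t))) := by
  have hβ : 0 ≤ 2 * c * √K := by positivity
  rcases le_total t (11 / 10) with h | h
  · refine (integral_clippedGap_le_quadratic hS hT hc ht.le (by rw [hw]; norm_num) hv).trans ?_
    set β := 2 * c * √K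
    -- Applying `1 + x ≤ exp x` to half the exponent and squaring keeps more precision than applying
    -- it directly.
    have e : Real.exp (-(t / (2 + t))) = Real.exp (-(t / (2 + t)) / 2) ^ 2 := by
      rw [← Real.exp_nat_mul]; congr 1; push_cast; ring
    have h1 : (4 + t) / (2 * (2 + t)) ≤ Real.exp (-(t / (2 + t)) / 2) := by
      refine le_trans (le_of_eq ?_) (Real.add_one_le_exp _)
      field_simp; ring
    rw [e]
    refine le_trans ?_ (pow_le_pow_left₀ (by positivity) h1 2)
    calc 1 - t * (797 / 1000 * w - β) + t ^ 2 * (w ^ 2 + β ^ 2) / 4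
        ≤ 1 - t * (52 / 100) + t ^ 2 * (2 / 10) := by
          have : β ^ 2 ≤ (176 / 1000) ^ 2 := pow_le_pow_left₀ hβ hcK 2
          have h2 : t ^ 2 * (w ^ 2 + β ^ 2) ≤ t ^ 2 * (8 / 10) :=
            mul_le_mul_of_nonneg_left (by rw [hw]; linarith) (sq_nonneg t)
          have h3 : t * (52 / 100) ≤ t * (797 / 1000 * w - β) :=
            mul_le_mul_of_nonneg_left (by rw [hw]; linarith) ht.le
          linarith
      _ ≤ _ := by
          rw [div_pow, le_div_iff₀ (by positivity)]
          have h4 : t ^ 2 ≤ 11 / 10 * t := by nlinarith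
          have h5 : t ^ 3 ≤ 11 / 10 * t ^ 2 := by nlinarith [sq_nonneg t]
          have h6 : t ^ 4 ≤ 11 / 10 * t ^ 3 := by nlinarith [pow_pos ht 3]
          nlinarith
  · refine (integral_clippedGap_le_inv hS hT hc ht (by linarith) hv).trans ?_
    set β := 2 * c * √K
    have e : Real.exp (-(t / (2 + t))) = Real.exp (-(t / (2 + t)) / 3) ^ 3 := by
      rw [← Real.exp_nat_mul]; congr 1; push_cast; ring
    have h1 : (6 + 2 * t) / (3 * (2 + t)) ≤ Real.exp (-(t / (2 + t)) / 3) := by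
      refine le_trans (le_of_eq ?_) (Real.add_one_le_exp _)
      field_simp; ring
    rw [e]
    refine le_trans ?_ (pow_le_pow_left₀ (by positivity) h1 3)
    calc 399 / 1000 * ((1 + 2 * t * β) / (t * (w - 2 * c)))
        ≤ 399 / 1000 * ((1 + 2 * t * (176 / 1000)) / (t * (751 / 1000))) := by
          gcongr; linarith
      _ ≤ _ := by
          rw [div_pow, ← mul_div_assoc, div_le_div_iff₀ (by positivity) (by positivity)]
          -- Shifted to the crossover point, the difference of the two sides has only nonnegative
          -- coefficients in `s`.
          obtain ⟨s, rfl⟩ : ∃ s, t = 11 / 10 + s := ⟨t - 11 / 10, by ring⟩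
          have hs : 0 ≤ s := by linarith
          rw [← sub_nonneg]
          ring_nf
          positivity

/-- A finer net brings `w` up to `0.98` and permits the larger rate `2t/(4+t)`, with crossover at
`3/2`. -/
theorem integral_clippedGap_le_exp_fine (hS : S.card ≤ K) (hT : T.card ≤ K) (hc : 0 ≤ c)
    (ht : 0 < t) (hc₁ : 2 * c ≤ 2 / 100) (hcK : 2 * c * √K ≤ 2 / 100)
    (hw : w = 98 / 100) (hv : v ⬝ᵥ v = 1) :
    ∫ a, clippedGap (t * (w * |a ⬝ᵥ v| - c * (normOn S a + normOn T a))) ∂(gaussianVectorLaw N)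
      ≤ Real.exp (-(2 * t / (4 + t))) := by
  have hβ : 0 ≤ 2 * c * √K := by positivity
  rcases le_total t (3 / 2) with h | h
  · refine (integral_clippedGap_le_quadratic hS hT hc ht.le (by rw [hw]; norm_num) hv).trans ?_
    set β := 2 * c * √K
    refine le_trans ?_ (Real.add_one_le_exp _)
    calc 1 - t * (797 / 1000 * w - β) + t ^ 2 * (w ^ 2 + β ^ 2) / 4
        ≤ 1 - t * (76 / 100) + t ^ 2 * (25 / 100) := by
          have : β ^ 2 ≤ (2 / 100) ^ 2 := pow_le_pow_left₀ hβ hcK 2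
          have h2 : t ^ 2 * (w ^ 2 + β ^ 2) ≤ t ^ 2 * 1 :=
            mul_le_mul_of_nonneg_left (by rw [hw]; linarith) (sq_nonneg t)
          have h3 : t * (76 / 100) ≤ t * (797 / 1000 * w - β) :=
            mul_le_mul_of_nonneg_left (by rw [hw]; linarith) ht.le
          linarith
      _ ≤ -(2 * t / (4 + t)) + 1 := by
          have : 2 * t / (4 + t) ≤ t * (76 / 100) - t ^ 2 * (25 / 100) := by
            rw [div_le_iff₀ (by positivity)]
            have h5 : t ^ 3 ≤ 3 / 2 * t ^ 2 := by nlinarith [sq_nonneg t]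
            nlinarith
          linarith
  · refine (integral_clippedGap_le_inv hS hT hc ht (by linarith) hv).trans ?_
    set β := 2 * c * √K
    have e : Real.exp (-(2 * t / (4 + t))) = Real.exp (-(2 * t / (4 + t)) / 4) ^ 4 := by
      rw [← Real.exp_nat_mul]; congr 1; push_cast; ring
    have h1 : (8 + t) / (2 * (4 + t)) ≤ Real.exp (-(2 * t / (4 + t)) / 4) := by
      refine le_trans (le_of_eq ?_) (Real.add_one_le_exp _)
      field_simp; ring
    rw [e]
    refine le_trans ?_ (pow_le_pow_left₀ (by positivity) h1 4)
    calc 399 / 1000 * ((1 + 2 * t * β) / (t * (w - 2 * c)))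
        ≤ 399 / 1000 * ((1 + 2 * t * (2 / 100)) / (t * (96 / 100))) := by
          gcongr; linarith
      _ ≤ _ := by
          rw [div_pow, ← mul_div_assoc, div_le_div_iff₀ (by positivity) (by positivity)]
          obtain ⟨s, rfl⟩ : ∃ s, t = 3 / 2 + s := ⟨t - 3 / 2, by ring⟩
          have hs : 0 ≤ s := by linarith
          rw [← sub_nonneg]
          ring_nf
          positivity

end Numerics

/-! ### The uniform dither -/

section Dither

/-- The uniform law on `[0, δ]`. -/
noncomputable abbrev uniformLaw (δ : ℝ) : Measure ℝ := cond volume (Set.Icc 0 δ)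

theorem isProbabilityMeasure_uniformLaw {δ : ℝ} (hδ : 0 < δ) :
    IsProbabilityMeasure (uniformLaw δ) :=
  cond_isProbabilityMeasure_of_finite (by simp [hδ]) (by simp)

/-- A Buffon-type estimate: the dithered floors of `b` and `b + h` agree with probability at
most `(1 - h / δ)₊`. -/
theorem volume_floor_le_floor_le {δ : ℝ} (hδ : 0 < δ) (b h : ℝ) :
    volume (Set.Icc 0 δ ∩ {ξ | ⌊(b + h + ξ) / δ⌋ ≤ ⌊(b + ξ) / δ⌋}) ≤ ENNReal.ofReal (δ - h) := by
  set k := ⌊b / δ⌋ with hk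
  have hk1 : k * δ ≤ b := (le_div_iff₀ hδ).1 (Int.floor_le _)
  have hk2 : b < (k + 1) * δ := (div_lt_iff₀ hδ).1 (Int.lt_floor_add_one _)
  set θ := b - k * δ with hθ
  -- As `ξ` runs over `[0, δ]`, `b + ξ` meets only the cells `k` and `k + 1`, with the change at `ξ
  -- = δ - θ`. Each interval collects the `ξ` for which `b + h + ξ` does not pass the upper end of
  -- that cell.
  have hsub : Set.Icc 0 δ ∩ {ξ | ⌊(b + h + ξ) / δ⌋ ≤ ⌊(b + ξ) / δ⌋} ⊆
      Set.Icc 0 (δ - θ - h) ∪ Set.Icc (δ - θ) (min δ (2 * δ - θ - h)) := by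
    rintro ξ ⟨⟨h0, h1⟩, hξ⟩
    simp only [Set.mem_ofPred_eq] at hξ
    set m := ⌊(b + ξ) / δ⌋ with hm
    have hm1 : m * δ ≤ b + ξ := (le_div_iff₀ hδ).1 (Int.floor_le _)
    have hm3 : b + h + ξ < (m + 1) * δ := by
      have := (div_lt_iff₀ hδ).1 (Int.lt_floor_add_one ((b + h + ξ) / δ))
      refine this.trans_le (mul_le_mul_of_nonneg_right ?_ hδ.le)
      have : ((⌊(b + h + ξ) / δ⌋ : ℤ) : ℝ) ≤ m := by exact_mod_cast hξ
      linarith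
    have hmk : k ≤ m := Int.floor_le_floor (by gcongr; linarith)
    have hmk' : m < k + 2 := by
      have : (m : ℝ) < k + 2 := by
        by_contra! hcon
        nlinarith
      exact_mod_cast this
    obtain hm' | hm' : m = k ∨ m = k + 1 := by omega
    · left
      rw [hm'] at hm3
      exact ⟨h0, by linarith⟩
    · right
      rw [hm'] at hm3 hm1
      push_cast at hm3 hm1
      exact ⟨by linarith, le_min h1 (by linarith)⟩
  refine (measure_mono hsub).trans ((measure_union_le _ _).trans ?_)
  rw [Real.volume_Icc, Real.volume_Icc, sub_zero]
  have hθ0 : 0 ≤ θ := by linarith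
  rcases le_total 0 (δ - θ - h) with h2 | h2
  · have h3 : min δ (2 * δ - θ - h) - (δ - θ) ≤ θ := by
      have := min_le_left δ (2 * δ - θ - h); linarith
    calc _ ≤ ENNReal.ofReal (δ - θ - h) + ENNReal.ofReal θ := by gcongr
      _ = ENNReal.ofReal (δ - h) := by rw [← ENNReal.ofReal_add h2 hθ0]; congr 1; ring
  · rw [ENNReal.ofReal_of_nonpos h2, zero_add]
    refine ENNReal.ofReal_le_ofReal ?_
    have := min_le_right δ (2 * δ - θ - h); linarith

theorem uniformLaw_floor_le_floor_le {δ : ℝ} (hδ : 0 < δ) (b h : ℝ) :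
    uniformLaw δ {ξ | ⌊(b + h + ξ) / δ⌋ ≤ ⌊(b + ξ) / δ⌋} ≤ ENNReal.ofReal (clippedGap (h / δ)) := by
  have := isProbabilityMeasure_uniformLaw hδ
  rcases le_total h 0 with hh | hh
  · have : clippedGap (h / δ) = 1 := by
      have : h / δ ≤ 0 := div_nonpos_of_nonpos_of_nonneg hh hδ.le
      rw [clippedGap, min_eq_left (by linarith), max_eq_right zero_le_one]
    rw [this, ENNReal.ofReal_one]
    exact prob_le_one
  · rw [cond_apply measurableSet_Icc]
    calc _ ≤ (volume (Set.Icc 0 δ))⁻¹ * ENNReal.ofReal (δ - h) := by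
          gcongr; exact volume_floor_le_floor_le hδ b h
      _ = ENNReal.ofReal (1 - h / δ) := by
          rw [Real.volume_Icc, sub_zero, mul_comm, ← div_eq_mul_inv, ← ENNReal.ofReal_div_of_pos hδ]
          congr 1; field_simp
      _ ≤ _ := by
          rcases le_total (1 - h / δ) 0 with h1 | h1
          · rw [ENNReal.ofReal_of_nonpos h1]; exact zero_le
          · refine ENNReal.ofReal_le_ofReal ?_
            have : 0 ≤ h / δ := by positivity
            rw [clippedGap, min_eq_right (by linarith), max_eq_right h1]

theorem measure_prod_floor_le_floor_le {Ω : Type*} [MeasurableSpace Ω] (P : Measure Ω)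
    [IsProbabilityMeasure P] {δ : ℝ} (hδ : 0 < δ) {b h : Ω → ℝ} (hb : Measurable b)
    (hh : Measurable h) :
    (P.prod (uniformLaw δ)) {p | ⌊(b p.1 + h p.1 + p.2) / δ⌋ ≤ ⌊(b p.1 + p.2) / δ⌋}
      ≤ ENNReal.ofReal (∫ ω, clippedGap (h ω / δ) ∂P) := by
  have := isProbabilityMeasure_uniformLaw hδ
  have hm : MeasurableSet {p : Ω × ℝ | ⌊(b p.1 + h p.1 + p.2) / δ⌋ ≤ ⌊(b p.1 + p.2) / δ⌋} :=
    measurableSet_le (by fun_prop) (by fun_prop)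
  rw [Measure.prod_apply hm, ofReal_integral_eq_lintegral_ofReal
    (integrable_clippedGap_comp (hh.div_const δ)) (ae_of_all _ fun _ => clippedGap_nonneg _)]
  exact lintegral_mono fun ω => uniformLaw_floor_le_floor_le hδ (b ω) (h ω)

end Dither

/-! ### Rows that fail to separate two balls -/

section RowEvent

variable {N : ℕ} {S T : Finset (Fin N)} {p q x y : EuclideanSpace ℝ (Fin N)} {δ r ε w ξ : ℝ}

theorem abs_dotProduct_le_of_supported {a : Fin N → ℝ} (hx : ‖x - p‖ ≤ r)
    (hS : ∀ j ∉ S, x j = p j) : |a ⬝ᵥ x.ofLp - a ⬝ᵥ p.ofLp| ≤ r * normOn S a := by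
  have e : a ⬝ᵥ x.ofLp - a ⬝ᵥ p.ofLp = ∑ j ∈ S, a j * (x - p) j := by
    rw [← dotProduct_sub, dotProduct]
    refine (Finset.sum_subset (Finset.subset_univ S) fun j _ hj => ?_).symm
    simp [hS j hj]
  have h1 : ∑ j ∈ S, (x - p) j ^ 2 ≤ r ^ 2 := by
    calc _ ≤ ∑ j, (x - p) j ^ 2 := Finset.sum_le_univ_sum_of_nonneg fun _ => sq_nonneg _
      _ = ‖x - p‖ ^ 2 := (EuclideanSpace.real_norm_sq_eq _).symm
      _ ≤ _ := pow_le_pow_left₀ (norm_nonneg _) hx 2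
  rw [e]
  have hr : 0 ≤ r := (norm_nonneg _).trans hx
  refine abs_le_of_sq_le_sq ?_ (mul_nonneg hr (normOn_nonneg _ _))
  refine (Finset.sum_mul_sq_le_sq_mul_sq _ _ _).trans ?_
  rw [mul_pow, normOn_sq, mul_comm]
  exact mul_le_mul_of_nonneg_right h1 (Finset.sum_nonneg fun _ _ => sq_nonneg _)

/-- A lower bound on the distance between the projections of two balls with centers `p`, `q`. -/
noncomputable def rowGap (r : ℝ) (S T : Finset (Fin N)) (p q : EuclideanSpace ℝ (Fin N))
    (a : Fin N → ℝ) : ℝ :=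
  |a ⬝ᵥ p.ofLp - a ⬝ᵥ q.ofLp| - r * (normOn S a + normOn T a)

/-- The lower end of the gap between the projections of two balls with centers `p`, `q`. -/
noncomputable def rowBase (r : ℝ) (S T : Finset (Fin N)) (p q : EuclideanSpace ℝ (Fin N))
    (a : Fin N → ℝ) : ℝ :=
  if a ⬝ᵥ p.ofLp ≤ a ⬝ᵥ q.ofLp then a ⬝ᵥ p.ofLp + r * normOn S a
  else a ⬝ᵥ q.ofLp + r * normOn T a

/-- The rows and dithers for which no quantization threshold separates the projections of the
balls with centers `p`, `q` and radius `r` in the coordinate subspaces `S`, `T`. -/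
def ambiguousRows (δ r : ℝ) (S T : Finset (Fin N)) (p q : EuclideanSpace ℝ (Fin N)) :
    Set ((Fin N → ℝ) × ℝ) :=
  {z | ⌊(rowBase r S T p q z.1 + rowGap r S T p q z.1 + z.2) / δ⌋
    ≤ ⌊(rowBase r S T p q z.1 + z.2) / δ⌋}

theorem measurable_dotProduct_const (v : Fin N → ℝ) : Measurable fun a : Fin N → ℝ => a ⬝ᵥ v := by
  unfold dotProduct; fun_prop

theorem measurable_rowGap : Measurable (rowGap r S T p q) := by
  have := measurable_dotProduct_const p.ofLp
  have := measurable_dotProduct_const q.ofLp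
  have := measurable_normOn S
  have := measurable_normOn T
  unfold rowGap; fun_prop

theorem measurable_rowBase : Measurable (rowBase r S T p q) := by
  have h1 := measurable_dotProduct_const p.ofLp
  have h2 := measurable_dotProduct_const q.ofLp
  have := measurable_normOn S
  have := measurable_normOn T
  exact Measurable.ite (measurableSet_le h1 h2) (by fun_prop) (by fun_prop)

theorem measurableSet_ambiguousRows : MeasurableSet (ambiguousRows δ r S T p q) := by
  have := measurable_rowGap (r := r) (S := S) (T := T) (p := p) (q := q)
  have := measurable_rowBase (r := r) (S := S) (T := T) (p := p) (q := q)
  exact measurableSet_le (by fun_prop) (by fun_prop)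

/-- The projections of `x` and `y` lie outside the open gap, on opposite sides, so equal cells for
them force equal cells for the ends of the gap. When the gap is negative the event holds by
monotonicity of the floor, which is why it is stated with `≤`. -/
theorem mem_ambiguousRows {a : Fin N → ℝ} (hδ : 0 < δ) (hx : ‖x - p‖ ≤ r) (hy : ‖y - q‖ ≤ r)
    (hS : ∀ j ∉ S, x j = p j) (hT : ∀ j ∉ T, y j = q j)
    (h : ⌊(a ⬝ᵥ x.ofLp + ξ) / δ⌋ = ⌊(a ⬝ᵥ y.ofLp + ξ) / δ⌋) :
    (a, ξ) ∈ ambiguousRows δ r S T p q := by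
  have h1 := abs_le.1 (abs_dotProduct_le_of_supported (a := a) hx hS)
  have h2 := abs_le.1 (abs_dotProduct_le_of_supported (a := a) hy hT)
  change ⌊(rowBase r S T p q a + rowGap r S T p q a + ξ) / δ⌋
    ≤ ⌊(rowBase r S T p q a + ξ) / δ⌋
  unfold rowBase rowGap
  split_ifs with hpq
  · rw [abs_of_nonpos (by linarith)]
    calc _ ≤ ⌊(a ⬝ᵥ y.ofLp + ξ) / δ⌋ := by gcongr; linarith
      _ = ⌊(a ⬝ᵥ x.ofLp + ξ) / δ⌋ := h.symm
      _ ≤ _ := by gcongr; linarith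
  · rw [abs_of_nonneg (by linarith)]
    calc _ ≤ ⌊(a ⬝ᵥ x.ofLp + ξ) / δ⌋ := by gcongr; linarith
      _ = ⌊(a ⬝ᵥ y.ofLp + ξ) / δ⌋ := h
      _ ≤ _ := by gcongr; linarith

/-- Only the direction of `p - q` matters: its length may be lowered to `w ε` because the clipped
gap is antitone. -/
theorem measure_ambiguousRows_le (hδ : 0 < δ) (hε : 0 < ε) (hw : 0 < w)
    (hpq : w * ε ≤ ‖p - q‖) {B : ℝ}
    (hB : ∀ v : Fin N → ℝ, v ⬝ᵥ v = 1 →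
      ∫ a, clippedGap (ε / δ * (w * |a ⬝ᵥ v| - r / ε * (normOn S a + normOn T a)))
        ∂(gaussianVectorLaw N) ≤ B) :
    ((gaussianVectorLaw N).prod (uniformLaw δ)) (ambiguousRows δ r S T p q) ≤ ENNReal.ofReal B := by
  refine (measure_prod_floor_le_floor_le (gaussianVectorLaw N) hδ measurable_rowBase
    measurable_rowGap).trans (ENNReal.ofReal_le_ofReal ?_)
  set d := ‖p - q‖
  have hd : 0 < d := lt_of_lt_of_le (by positivity) hpq
  have hv : (d⁻¹ • (p - q)).ofLp ⬝ᵥ (d⁻¹ • (p - q)).ofLp = 1 := by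
    have : ‖d⁻¹ • (p - q)‖ ^ 2 = 1 := by
      rw [norm_smul, norm_inv, norm_norm, inv_mul_cancel₀ hd.ne', one_pow]
    rw [EuclideanSpace.real_norm_sq_eq] at this
    rw [← this, dotProduct]
    simp only [sq]
  refine le_trans ?_ (hB _ hv)
  have m1 := measurable_dotProduct_const (d⁻¹ • (p - q)).ofLp
  have m2 := measurable_normOn S
  have m3 := measurable_normOn T
  refine integral_mono (integrable_clippedGap_comp (measurable_rowGap.div_const δ))
    (integrable_clippedGap_comp (by fun_prop)) fun a => clippedGap_antitone ?_
  have e : |a ⬝ᵥ p.ofLp - a ⬝ᵥ q.ofLp| = d * |a ⬝ᵥ (d⁻¹ • (p - q)).ofLp| := by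
    simp only [WithLp.ofLp_smul, WithLp.ofLp_sub, dotProduct_smul, dotProduct_sub, smul_eq_mul,
      abs_mul, abs_inv, abs_of_pos hd]
    field_simp
  have h1 : ε / δ * (w * |a ⬝ᵥ (d⁻¹ • (p - q)).ofLp| - r / ε * (normOn S a + normOn T a))
      = (w * ε * |a ⬝ᵥ (d⁻¹ • (p - q)).ofLp| - r * (normOn S a + normOn T a)) / δ := by
    field_simp
  rw [h1, rowGap, e]
  gcongr

theorem measure_ambiguousRows_le_exp_coarse {K : ℕ} (hδ : 0 < δ) (hε : 0 < ε) (hr : 0 ≤ r)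
    (hS : S.card ≤ K) (hT : T.card ≤ K) (hr₁ : 2 * r ≤ 1245 / 10000 * ε)
    (hrK : 2 * r * √K ≤ 176 / 1000 * ε) (hpq : ε - 2 * r ≤ ‖p - q‖) :
    ((gaussianVectorLaw N).prod (uniformLaw δ)) (ambiguousRows δ r S T p q)
      ≤ ENNReal.ofReal (Real.exp (-(ε / (2 * δ + ε)))) := by
  refine measure_ambiguousRows_le (w := 8755 / 10000) hδ hε (by norm_num) (by linarith)
    fun v hv => ?_
  have e : ε / (2 * δ + ε) = (ε / δ) / (2 + ε / δ) := by field_simp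
  rw [e]
  refine integral_clippedGap_le_exp_coarse hS hT (by positivity) (by positivity) ?_ ?_ rfl hv
  · rw [← mul_div_assoc, div_le_iff₀ hε]; exact hr₁
  · rw [← mul_div_assoc, div_mul_eq_mul_div, div_le_iff₀ hε]; exact hrK

theorem measure_ambiguousRows_le_exp_fine {K : ℕ} (hδ : 0 < δ) (hε : 0 < ε) (hr : 0 ≤ r)
    (hS : S.card ≤ K) (hT : T.card ≤ K) (hr₁ : 2 * r ≤ 2 / 100 * ε)
    (hrK : 2 * r * √K ≤ 2 / 100 * ε) (hpq : ε - 2 * r ≤ ‖p - q‖) :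
    ((gaussianVectorLaw N).prod (uniformLaw δ)) (ambiguousRows δ r S T p q)
      ≤ ENNReal.ofReal (Real.exp (-(2 * ε / (4 * δ + ε)))) := by
  refine measure_ambiguousRows_le (w := 98 / 100) hδ hε (by norm_num) (by linarith)
    fun v hv => ?_
  have e : 2 * ε / (4 * δ + ε) = 2 * (ε / δ) / (4 + ε / δ) := by field_simp
  rw [e]
  refine integral_clippedGap_le_exp_fine hS hT (by positivity) (by positivity) ?_ ?_ rfl hv
  · rw [← mul_div_assoc, div_le_iff₀ hε]; exact hr₁
  · rw [← mul_div_assoc, div_mul_eq_mul_div, div_le_iff₀ hε]; exact hrK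

end RowEvent

/-! ### The union bound -/

section UnionBound

/-- Keep one term of `(ρ + 1)^M ≤ exp (ρ M)`, and use `ρ^R ≥ ρ^(ρM)` since `ρ ≤ 1`. -/
theorem choose_le_exp_mul_log {M R : ℕ} {ρ : ℝ} (hρ₀ : 0 < ρ) (hρ₁ : ρ ≤ 1) (hR : (R : ℝ) ≤ ρ * M) :
    (M.choose R : ℝ) ≤ Real.exp (ρ * M * Real.log (Real.exp 1 / ρ)) := by
  have h1 : (M.choose R : ℝ) * ρ ^ R ≤ Real.exp (ρ * M) := by
    calc (M.choose R : ℝ) * ρ ^ R ≤ (ρ + 1) ^ M := by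
          rcases le_or_gt R M with hRM | hRM
          · rw [add_pow]
            refine le_trans (le_of_eq ?_) (Finset.single_le_sum (f := fun m =>
              ρ ^ m * 1 ^ (M - m) * (M.choose m : ℝ)) (fun i _ => by positivity)
              (Finset.mem_range.2 (Nat.lt_succ_of_le hRM)))
            simp [mul_comm]
          · rw [Nat.choose_eq_zero_of_lt hRM]; simp; positivity
      _ ≤ Real.exp ρ ^ M := by gcongr; exact Real.add_one_le_exp ρ
      _ = Real.exp (ρ * M) := by rw [← Real.exp_nat_mul, mul_comm]
  have hl : Real.log ρ ≤ 0 := Real.log_nonpos hρ₀.le hρ₁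
  have h2 : ρ ^ R = Real.exp (R * Real.log ρ) := by
    rw [Real.exp_nat_mul, Real.exp_log hρ₀]
  rw [h2, ← le_div_iff₀ (Real.exp_pos _), ← Real.exp_sub] at h1
  refine h1.trans (Real.exp_le_exp.2 ?_)
  rw [Real.log_div (Real.exp_pos 1).ne' hρ₀.ne', Real.log_exp]
  nlinarith

theorem two_mul_card_filter_lt_le (n : ℕ) :
    2 * ((Finset.univ : Finset (Fin n × Fin n)).filter fun z => z.1 < z.2).card ≤ n ^ 2 := by
  have h : ((Finset.univ : Finset (Fin n × Fin n)).filter fun z => z.1 < z.2).card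
      = ((Finset.univ : Finset (Fin n × Fin n)).filter fun z => z.2 < z.1).card :=
    Finset.card_equiv (Equiv.prodComm _ _) (by simp)
  have hd : Disjoint ((Finset.univ : Finset (Fin n × Fin n)).filter fun z => z.1 < z.2)
      ((Finset.univ : Finset (Fin n × Fin n)).filter fun z => z.2 < z.1) := by
    rw [Finset.disjoint_filter]
    intro z _ h1 h2
    exact lt_asymm h1 h2
  rw [two_mul]
  nth_rw 2 [h]
  rw [← Finset.card_union_of_disjoint hd]
  refine (Finset.card_le_univ _).trans ?_
  simp [sq]

theorem sensingLaw_forall_mem_le {M N : ℕ} {δ : ℝ} (hδ : 0 < δ) {B : Set ((Fin N → ℝ) × ℝ)}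
    (hB : MeasurableSet B) {b : ENNReal}
    (hb : ((gaussianVectorLaw N).prod (uniformLaw δ)) B ≤ b) (I : Finset (Fin M)) :
    sensingLaw M N δ {ω | ∀ m ∈ I, (ω.1 m, ω.2 m) ∈ B} ≤ b ^ I.card := by
  have := isProbabilityMeasure_uniformLaw hδ
  have hmp := measurePreserving_arrowProdEquivProdArrow (Fin N → ℝ) ℝ (Fin M)
    (fun _ => gaussianVectorLaw N) (fun _ => uniformLaw δ)
  have hm : MeasurableSet {ω : (Fin M → Fin N → ℝ) × (Fin M → ℝ) |
      ∀ m ∈ I, (ω.1 m, ω.2 m) ∈ B} := by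
    have : {ω : (Fin M → Fin N → ℝ) × (Fin M → ℝ) | ∀ m ∈ I, (ω.1 m, ω.2 m) ∈ B} =
        ⋂ m ∈ I, (fun ω => (ω.1 m, ω.2 m)) ⁻¹' B := by ext; simp
    rw [this]
    refine Finset.measurableSet_biInter _ fun m _ => ?_
    exact (((measurable_pi_apply m).comp measurable_fst).prodMk
      ((measurable_pi_apply m).comp measurable_snd)) hB
  change ((Measure.pi fun _ : Fin M => gaussianVectorLaw N).prod
    (Measure.pi fun _ : Fin M => uniformLaw δ)) _ ≤ _
  rw [← hmp.measure_preimage hm.nullMeasurableSet]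
  have e : MeasurableEquiv.arrowProdEquivProdArrow (Fin N → ℝ) ℝ (Fin M) ⁻¹'
      {ω | ∀ m ∈ I, (ω.1 m, ω.2 m) ∈ B} = Set.pi I fun _ => B := by
    ext f; rfl
  rw [e, Measure.pi_pi_finset]
  refine (Finset.prod_le_pow_card _ _ b fun _ _ => hb)

theorem isProbabilityMeasure_sensingLaw (M N : ℕ) {δ : ℝ} (hδ : 0 < δ) :
    IsProbabilityMeasure (sensingLaw M N δ) := by
  have := isProbabilityMeasure_uniformLaw hδ
  unfold sensingLaw gaussianMatrixLaw uniformDitherLaw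
  infer_instance

/-- If the quantized projections are close in `ℓ₁`, most of their rows are in the same cell. -/
theorem exists_card_eq_forall_floor_eq {M N : ℕ} {δ ρ : ℝ} (hδ : 0 < δ)
    {Φ : Fin M → Fin N → ℝ} {ξ : Fin M → ℝ} {x y : EuclideanSpace ℝ (Fin N)}
    (h : l1Dist (quantizedProjection δ Φ ξ x) (quantizedProjection δ Φ ξ y) ≤ ρ * δ * M) :
    ∃ I : Finset (Fin M), I.card = M - ⌊ρ * M⌋₊ ∧
      ∀ m ∈ I, ⌊(Φ m ⬝ᵥ x.ofLp + ξ m) / δ⌋ = ⌊(Φ m ⬝ᵥ y.ofLp + ξ m) / δ⌋ := by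
  -- The inconsistent rows. Distinct floors differ by at least one, so each such row contributes at
  -- least `δ`.
  set D := Finset.univ.filter fun m : Fin M =>
    ¬ ⌊(Φ m ⬝ᵥ x.ofLp + ξ m) / δ⌋ = ⌊(Φ m ⬝ᵥ y.ofLp + ξ m) / δ⌋ with hD
  have h1 : δ * D.card ≤ ρ * δ * M := by
    calc δ * D.card = ∑ m ∈ D, δ := by rw [Finset.sum_const, nsmul_eq_mul, mul_comm]
      _ ≤ ∑ m ∈ D, |quantizedProjection δ Φ ξ x m - quantizedProjection δ Φ ξ y m| := by
          refine Finset.sum_le_sum fun m hm => ?_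
          have hm' := (Finset.mem_filter.1 hm).2
          have e : quantizedProjection δ Φ ξ x m - quantizedProjection δ Φ ξ y m
              = δ * ((⌊(Φ m ⬝ᵥ x.ofLp + ξ m) / δ⌋ - ⌊(Φ m ⬝ᵥ y.ofLp + ξ m) / δ⌋ : ℤ) : ℝ) := by
            push_cast
            change δ * (_ + 1 / 2) - δ * (_ + 1 / 2) = δ * (_ - _)
            simp only [Matrix.mulVec, Matrix.of_apply]
            ring
          rw [e, abs_mul, abs_of_pos hδ]
          refine le_mul_of_one_le_right hδ.le ?_
          rw [← Int.cast_abs]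
          exact_mod_cast Int.one_le_abs (sub_ne_zero.2 hm')
      _ ≤ _ := (Finset.sum_le_univ_sum_of_nonneg fun _ => abs_nonneg _).trans h
  have h2 : D.card ≤ ⌊ρ * M⌋₊ := by
    refine Nat.le_floor ?_
    have : δ * D.card ≤ δ * (ρ * M) := by linarith
    exact le_of_mul_le_mul_left this hδ
  have h3 : M - ⌊ρ * M⌋₊ ≤ Dᶜ.card := by
    rw [Finset.card_compl, Fintype.card_fin]; omega
  obtain ⟨I, hI, hc⟩ := Finset.exists_subset_card_eq h3
  refine ⟨I, hc, fun m hm => ?_⟩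
  have := hI hm
  simpa [hD] using this

/-- The union bound over the sets of consistent rows and over the pairs of a finite net. -/
theorem holdsWithProbAtLeast_of_net {M N n : ℕ} {δ ε r ρ η b : ℝ} (hδ : 0 < δ) (hb : 0 ≤ b)
    (hη : 0 ≤ η) (hrε : 2 * r ≤ ε)
    {A : Set (EuclideanSpace ℝ (Fin N))} {p : Fin n → EuclideanSpace ℝ (Fin N)}
    {S : Fin n → Finset (Fin N)}
    (hA : ∀ x ∈ A, ∃ i, ‖x - p i‖ ≤ r ∧ ∀ j ∉ S i, x j = p i j)
    (hrow : ∀ i j, ε - 2 * r ≤ ‖p i - p j‖ →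
      ((gaussianVectorLaw N).prod (uniformLaw δ)) (ambiguousRows δ r (S i) (S j) (p i) (p j))
        ≤ ENNReal.ofReal b)
    (hbound : (M.choose ⌊ρ * M⌋₊ : ℝ) * ((n : ℝ) ^ 2 / 2) * b ^ (M - ⌊ρ * M⌋₊) ≤ η)
    (hR : ⌊ρ * M⌋₊ ≤ M) :
    HoldsWithProbAtLeast (sensingLaw M N δ) (1 - η) fun ω => ∀ x ∈ A, ∀ y ∈ A,
      l1Dist (quantizedProjection δ ω.1 ω.2 x) (quantizedProjection δ ω.1 ω.2 y) ≤ ρ * δ * M →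
        ‖x - y‖ ≤ ε := by
  classical
  have := isProbabilityMeasure_sensingLaw M N hδ
  set R := ⌊ρ * M⌋₊
  -- Ordered pairs `i < j` suffice because equality of cells is symmetric in `x` and `y`; this gives
  -- the factor `1/2` in `n²/2`.
  let J : Finset (Fin n × Fin n) := Finset.univ.filter fun z =>
    z.1 < z.2 ∧ ε - 2 * r ≤ ‖p z.1 - p z.2‖
  let bad (I : Finset (Fin M)) (z : Fin n × Fin n) : Set ((Fin M → Fin N → ℝ) × (Fin M → ℝ)) :=
    {ω | ∀ m ∈ I, (ω.1 m, ω.2 m) ∈ ambiguousRows δ r (S z.1) (S z.2) (p z.1) (p z.2)}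
  let C : Finset (Finset (Fin M)) := Finset.powersetCard (M - R) Finset.univ
  let Bad := ⋃ I ∈ C, ⋃ z ∈ J, bad I z
  have hbad (I : Finset (Fin M)) (z : Fin n × Fin n) : MeasurableSet (bad I z) := by
    have : bad I z = ⋂ m ∈ I, (fun ω : (Fin M → Fin N → ℝ) × (Fin M → ℝ) => (ω.1 m, ω.2 m)) ⁻¹'
        ambiguousRows δ r (S z.1) (S z.2) (p z.1) (p z.2) := by ext; simp [bad]
    rw [this]
    refine Finset.measurableSet_biInter _ fun m _ => ?_
    exact (((measurable_pi_apply m).comp measurable_fst).prodMk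
      ((measurable_pi_apply m).comp measurable_snd)) measurableSet_ambiguousRows
  have hBad : MeasurableSet Bad := Finset.measurableSet_biUnion _ fun I _ =>
    Finset.measurableSet_biUnion _ fun z _ => hbad I z
  have hJ : (J.card : ℝ) ≤ (n : ℝ) ^ 2 / 2 := by
    have h1 : J.card ≤ ((Finset.univ : Finset (Fin n × Fin n)).filter fun z => z.1 < z.2).card :=
      Finset.card_le_card fun z hz => by
        simp only [J, Finset.mem_filter] at hz ⊢
        exact ⟨hz.1, hz.2.1⟩
    have h2 := two_mul_card_filter_lt_le n
    have : (2 * J.card : ℝ) ≤ (n : ℝ) ^ 2 := by exact_mod_cast (by omega : 2 * J.card ≤ n ^ 2)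
    linarith
  have hPBad : sensingLaw M N δ Bad ≤ ENNReal.ofReal η := by
    calc sensingLaw M N δ Bad ≤ ∑ I ∈ C, ∑ z ∈ J, sensingLaw M N δ (bad I z) :=
          (measure_biUnion_finset_le _ _).trans
            (Finset.sum_le_sum fun I _ => measure_biUnion_finset_le _ _)
      _ ≤ ∑ I ∈ C, ∑ z ∈ J, ENNReal.ofReal (b ^ (M - R)) := by
          refine Finset.sum_le_sum fun I hI => Finset.sum_le_sum fun z hz => ?_
          have hz' := (Finset.mem_filter.1 hz).2
          refine (sensingLaw_forall_mem_le hδ measurableSet_ambiguousRows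
            (hrow z.1 z.2 hz'.2) I).trans ?_
          rw [(Finset.mem_powersetCard.1 hI).2, ENNReal.ofReal_pow hb]
      _ = ENNReal.ofReal (C.card * J.card * b ^ (M - R)) := by
          rw [Finset.sum_const, Finset.sum_const, nsmul_eq_mul, nsmul_eq_mul,
            ENNReal.ofReal_mul (by positivity), ENNReal.ofReal_mul (by positivity),
            ENNReal.ofReal_natCast, ENNReal.ofReal_natCast, mul_assoc]
      _ ≤ ENNReal.ofReal η := by
          refine ENNReal.ofReal_le_ofReal (le_trans ?_ hbound)
          have : C.card = M.choose R := by
            rw [Finset.card_powersetCard, Finset.card_univ, Fintype.card_fin,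
              Nat.choose_symm hR]
          rw [this]
          gcongr
  refine ⟨Badᶜ, hBad.compl, ?_, fun ω hω x hx y hy hxy => ?_⟩
  · rw [prob_compl_eq_one_sub hBad, ENNReal.ofReal_sub _ hη, ENNReal.ofReal_one]
    exact tsub_le_tsub_left hPBad 1
  · by_contra! hlt
    obtain ⟨I, hI, hfloor⟩ := exists_card_eq_forall_floor_eq hδ hxy
    have hIC : I ∈ C := Finset.mem_powersetCard.2 ⟨Finset.subset_univ _, hI⟩
    obtain ⟨i, hi, hi'⟩ := hA x hx
    obtain ⟨j, hj, hj'⟩ := hA y hy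
    have hfar : ε - 2 * r ≤ ‖p i - p j‖ := by
      have e : x - y = (x - p i) + (p i - p j) - (y - p j) := by abel
      have h1 := norm_sub_le ((x - p i) + (p i - p j)) (y - p j)
      have h2 := norm_add_le (x - p i) (p i - p j)
      rw [← e] at h1
      linarith
    rcases lt_trichotomy i j with hij | hij | hij
    · refine hω (Set.mem_biUnion hIC (Set.mem_biUnion (x := (i, j)) ?_ fun m hm => ?_))
      · exact Finset.mem_coe.2 (Finset.mem_filter.2 ⟨Finset.mem_univ _, hij, hfar⟩)
      · exact mem_ambiguousRows hδ hi hj hi' hj' (hfloor m hm)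
    -- Two vectors near the same net point are within `2r ≤ ε` of each other.
    · subst hij
      have e : x - y = (x - p i) - (y - p i) := by abel
      have h1 := norm_sub_le (x - p i) (y - p i)
      rw [← e] at h1
      linarith
    · refine hω (Set.mem_biUnion hIC (Set.mem_biUnion (x := (j, i)) ?_ fun m hm => ?_))
      · rw [norm_sub_rev] at hfar
        exact Finset.mem_coe.2 (Finset.mem_filter.2 ⟨Finset.mem_univ _, hij, hfar⟩)
      · exact mem_ambiguousRows hδ hj hi hj' hi' (hfloor m hm).symm

end UnionBound

/-! ### Nets of the ball and of the sparse vectors -/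

section Nets

/-- The volumetric bound on separated sets in the unit ball. -/
theorem card_le_of_separated_closedBall {E : Type*} [NormedAddCommGroup E] [NormedSpace ℝ E]
    [FiniteDimensional ℝ E] {r : ℝ} (hr : 0 < r) (s : Finset E) (hs : ∀ x ∈ s, ‖x‖ ≤ 1)
    (hsep : ∀ x ∈ s, ∀ y ∈ s, x ≠ y → r ≤ ‖x - y‖) :
    (s.card : ℝ) ≤ (1 + 2 / r) ^ Module.finrank ℝ E := by
  borelize E
  let μ : Measure E := Measure.addHaar
  set D := Module.finrank ℝ E
  have hr2 : 0 < r / 2 := by positivity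
  have hR : 0 < 1 + r / 2 := by positivity
  -- Balls of radius `r/2` around the points are disjoint and fit in the ball of radius `1 + r/2`;
  -- volumes are then compared.
  have hdis : Set.Pairwise (s : Set E) (Function.onFun Disjoint fun x => Metric.ball x (r / 2)) := by
    intro x hx y hy hxy
    refine Metric.ball_disjoint_ball ?_
    rw [dist_eq_norm]
    linarith [hsep x hx y hy hxy]
  have hsub : (⋃ x ∈ s, Metric.ball x (r / 2)) ⊆ Metric.ball (0 : E) (1 + r / 2) := by
    refine Set.iUnion₂_subset fun x hx => Metric.ball_subset_ball' ?_
    rw [dist_zero_right]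
    linarith [hs x hx]
  have h1 : (s.card : ENNReal) * ENNReal.ofReal ((r / 2) ^ D) * μ (Metric.ball 0 1)
      ≤ ENNReal.ofReal ((1 + r / 2) ^ D) * μ (Metric.ball 0 1) := by
    calc _ = ∑ x ∈ s, μ (Metric.ball x (r / 2)) := by
          simp only [μ.addHaar_ball_of_pos _ hr2, Finset.sum_const, nsmul_eq_mul, mul_assoc]
          rfl
      _ = μ (⋃ x ∈ s, Metric.ball x (r / 2)) :=
          (measure_biUnion_finset hdis fun _ _ => measurableSet_ball).symm
      _ ≤ μ (Metric.ball (0 : E) (1 + r / 2)) := measure_mono hsub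
      _ = _ := by rw [μ.addHaar_ball_of_pos _ hR]
  have h2 : (s.card : ENNReal) * ENNReal.ofReal ((r / 2) ^ D) ≤ ENNReal.ofReal ((1 + r / 2) ^ D) :=
    (ENNReal.mul_le_mul_iff_left (Metric.measure_ball_pos _ _ zero_lt_one).ne'
      measure_ball_lt_top.ne).1 h1
  rw [← ENNReal.ofReal_natCast, ← ENNReal.ofReal_mul (Nat.cast_nonneg _),
    ENNReal.ofReal_le_ofReal_iff (by positivity)] at h2
  have h3 : (1 + 2 / r) ^ D = (1 + r / 2) ^ D / (r / 2) ^ D := by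
    rw [← div_pow]; congr 1; field_simp; ring
  rw [h3, le_div_iff₀ (by positivity)]
  exact h2

/-- A separated set of largest cardinality is a net, since an uncovered point could be added to it.
-/
theorem exists_net_unitBall (E : Type*) [NormedAddCommGroup E] [NormedSpace ℝ E]
    [FiniteDimensional ℝ E] {r : ℝ} (hr : 0 < r) :
    ∃ (n : ℕ) (p : Fin n → E), (n : ℝ) ≤ (1 + 2 / r) ^ Module.finrank ℝ E ∧
      ∀ x : E, ‖x‖ ≤ 1 → ∃ i, ‖x - p i‖ ≤ r := by
  classical
  let A : Set ℕ := {k | ∃ s : Finset E, (∀ x ∈ s, ‖x‖ ≤ 1) ∧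
    (∀ x ∈ s, ∀ y ∈ s, x ≠ y → r ≤ ‖x - y‖) ∧ s.card = k}
  have hne : A.Nonempty := ⟨0, ∅, by simp⟩
  have hbd : BddAbove A := by
    refine ⟨⌊(1 + 2 / r) ^ Module.finrank ℝ E⌋₊, ?_⟩
    rintro k ⟨s, hs, hsep, rfl⟩
    exact Nat.le_floor (card_le_of_separated_closedBall hr s hs hsep)
  obtain ⟨s, hs, hsep, hcard⟩ := Nat.sSup_mem hne hbd
  refine ⟨s.card, fun i => (s.equivFin.symm i : E), card_le_of_separated_closedBall hr s hs hsep,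
    fun x hx => ?_⟩
  by_contra! hfar
  have hfar' : ∀ y ∈ s, r < ‖x - y‖ := fun y hy => by
    simpa using hfar (s.equivFin ⟨y, hy⟩)
  have hxs : x ∉ s := fun h => by
    have := hfar' x h
    simp at this
    linarith
  have hmem : (insert x s).card ∈ A := by
    refine ⟨insert x s, fun y hy => ?_, fun y hy z hz hyz => ?_, rfl⟩
    · rcases Finset.mem_insert.1 hy with rfl | hy
      · exact hx
      · exact hs y hy
    · rcases Finset.mem_insert.1 hy with hy | hy <;> rcases Finset.mem_insert.1 hz with hz | hz
      · exact absurd (hy.trans hz.symm) hyz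
      · rw [hy]; exact (hfar' z hz).le
      · rw [hz, norm_sub_rev]; exact (hfar' y hy).le
      · exact hsep y hy z hz hyz
  have := le_csSup hbd hmem
  rw [Finset.card_insert_of_notMem hxs] at this
  omega

/-- On the line, intervals of length `2r` tile `[-1, 1]`. This improves on the volumetric count `1 +
2/r`, which is too large for the constant `29` when `N = 1`. -/
theorem exists_net_unitBall_fin_one {r : ℝ} (hr : 0 < r) :
    ∃ (n : ℕ) (p : Fin n → EuclideanSpace ℝ (Fin 1)), (n : ℝ) ≤ 1 + 1 / r ∧
      ∀ x : EuclideanSpace ℝ (Fin 1), ‖x‖ ≤ 1 → ∃ i, ‖x - p i‖ ≤ r := by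
  refine ⟨⌊1 / r⌋₊ + 1, fun i => WithLp.toLp 2 fun _ => -1 + (2 * (i : ℕ) + 1) * r, ?_,
    fun x hx => ?_⟩
  · push_cast
    linarith [Nat.floor_le (by positivity : 0 ≤ 1 / r)]
  · rw [EuclideanSpace.norm_eq] at hx
    simp only [Finset.univ_unique, Fin.default_eq_zero, Fin.isValue, Real.norm_eq_abs, sq_abs,
      Finset.sum_singleton, Real.sqrt_sq_eq_abs] at hx
    obtain ⟨h1, h2⟩ := abs_le.1 hx
    have h0 : 0 ≤ (x 0 + 1) / (2 * r) := div_nonneg (by linarith) (by positivity)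
    have hlt : ⌊(x 0 + 1) / (2 * r)⌋₊ < ⌊1 / r⌋₊ + 1 := by
      refine Nat.lt_succ_of_le (Nat.floor_le_floor ?_)
      rw [div_le_div_iff₀ (by positivity) hr]
      nlinarith
    refine ⟨⟨_, hlt⟩, ?_⟩
    rw [EuclideanSpace.norm_eq]
    simp only [Finset.univ_unique, Fin.default_eq_zero, Fin.isValue, Real.norm_eq_abs, sq_abs,
      Finset.sum_singleton, Real.sqrt_sq_eq_abs, PiLp.sub_apply]
    have h3 := (le_div_iff₀ (by positivity)).1 (Nat.floor_le h0)
    have h4 := (div_lt_iff₀ (by positivity)).1 (Nat.lt_floor_add_one ((x 0 + 1) / (2 * r)))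
    rw [abs_le]
    constructor <;> linarith

/-- Extension by zero of a vector indexed by a set of coordinates. -/
def zeroExtend {N : ℕ} (T : Finset (Fin N)) (y : EuclideanSpace ℝ T) : EuclideanSpace ℝ (Fin N) :=
  WithLp.toLp 2 fun j => if h : j ∈ T then y ⟨j, h⟩ else 0

theorem norm_sub_zeroExtend {N : ℕ} {T : Finset (Fin N)} {x : EuclideanSpace ℝ (Fin N)}
    (hx : ∀ j ∉ T, x j = 0) (y : EuclideanSpace ℝ T) :
    ‖x - zeroExtend T y‖ = ‖WithLp.toLp 2 (fun j : T => x j) - y‖ := by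
  rw [EuclideanSpace.norm_eq, EuclideanSpace.norm_eq]
  congr 1
  rw [← Finset.sum_subset (Finset.subset_univ T), ← Finset.sum_coe_sort T]
  · refine Finset.sum_congr rfl fun j _ => ?_
    simp [zeroExtend]
  · intro j _ hj
    simp [zeroExtend, hj, hx j hj]

/-- One net per support of size exactly `K`; smaller supports are enlarged. The number of supports
is at most `(eN/K)^K`. -/
theorem exists_net_sparseVectors {N K : ℕ} (hK : 1 ≤ K) (hKN : K ≤ N) {r : ℝ} (hr : 0 < r) :
    ∃ (n : ℕ) (p : Fin n → EuclideanSpace ℝ (Fin N)) (S : Fin n → Finset (Fin N)),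
      (n : ℝ) ≤ (Real.exp 1 * N / K * (1 + 2 / r)) ^ K ∧ (∀ i, (S i).card ≤ K) ∧
      ∀ x ∈ sparseVectors N K ∩ unitBall N, ∃ i, ‖x - p i‖ ≤ r ∧ ∀ j ∉ S i, x j = p i j := by
  classical
  have hK0 : (0 : ℝ) < K := by exact_mod_cast hK
  have hN0 : (0 : ℝ) < N := by exact_mod_cast hK.trans hKN
  choose n p hn hp using fun T : Finset (Fin N) => exists_net_unitBall (EuclideanSpace ℝ T) hr
  let ι := Σ T : {T : Finset (Fin N) // T ∈ Finset.powersetCard K Finset.univ}, Fin (n T)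
  let e : ι ≃ Fin (Fintype.card ι) := Fintype.equivFin ι
  refine ⟨Fintype.card ι, fun i => zeroExtend _ (p _ (e.symm i).2), fun i => (e.symm i).1, ?_,
    fun i => ((Finset.mem_powersetCard.1 (e.symm i).1.2).2).le, fun x hx => ?_⟩
  · have h1 : ((N.choose K : ℕ) : ℝ) ≤ (Real.exp 1 * N / K) ^ K := by
      refine (choose_le_exp_mul_log (ρ := K / N) (by positivity) ?_ ?_).trans (le_of_eq ?_)
      · rw [div_le_one hN0]; exact_mod_cast hKN
      · rw [div_mul_cancel₀ _ hN0.ne']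
      · rw [div_mul_cancel₀ _ hN0.ne', Real.exp_nat_mul, Real.exp_log (by positivity)]
        congr 1; field_simp
    have h2 : (Fintype.card ι : ℝ) ≤ N.choose K * (1 + 2 / r) ^ K := by
      rw [Fintype.card_sigma]
      push_cast
      calc _ ≤ ∑ T : {T : Finset (Fin N) // T ∈ Finset.powersetCard K Finset.univ},
            (1 + 2 / r) ^ K := by
            refine Finset.sum_le_sum fun T _ => ?_
            have := hn T
            rw [finrank_euclideanSpace, Fintype.card_coe,
              (Finset.mem_powersetCard.1 T.2).2] at this
            simpa using this
        _ = _ := by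
            rw [Finset.sum_const, nsmul_eq_mul, Finset.card_univ, Fintype.card_coe,
              Finset.card_powersetCard, Finset.card_univ, Fintype.card_fin]
    rw [mul_pow]
    exact h2.trans (by gcongr)
  · obtain ⟨hxs, hxb⟩ := hx
    obtain ⟨T, hT, hTc⟩ := Finset.exists_superset_card_eq (s := Finset.univ.filter fun j => x j ≠ 0)
      (n := K) hxs (by simpa using hKN)
    have hx0 : ∀ j ∉ T, x j = 0 := fun j hj => by
      by_contra h
      exact hj (hT (Finset.mem_filter.2 ⟨Finset.mem_univ _, h⟩))
    have hxn : ‖WithLp.toLp 2 (fun j : T => x j)‖ ≤ 1 := by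
      have h0 := norm_sub_zeroExtend hx0 0
      have hz : zeroExtend T 0 = 0 := by ext j; simp [zeroExtend]
      rw [hz, sub_zero, sub_zero] at h0
      rw [← h0]; exact hxb
    obtain ⟨i, hi⟩ := hp T _ hxn
    refine ⟨e ⟨⟨T, Finset.mem_powersetCard.2 ⟨Finset.subset_univ _, hTc⟩⟩, i⟩, ?_, ?_⟩
    · beta_reduce
      rw [Equiv.symm_apply_apply, norm_sub_zeroExtend hx0]; exact hi
    · beta_reduce
      rw [Equiv.symm_apply_apply]
      intro j hj
      rw [hx0 j hj]
      simp [zeroExtend, hj]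

end Nets

/-! ### The constants and the exponent balance -/

section Constants

variable {ρ : ℝ}

theorem log_exp_one_div (hρ₀ : 0 < ρ) : Real.log (Real.exp 1 / ρ) = 1 - Real.log ρ := by
  rw [Real.log_div (Real.exp_pos 1).ne' hρ₀.ne', Real.log_exp]

theorem one_le_log_exp_one_div (hρ₀ : 0 < ρ) (hρ₁ : ρ < 1) :
    1 ≤ Real.log (Real.exp 1 / ρ) := by
  rw [log_exp_one_div hρ₀]
  linarith [Real.log_nonpos hρ₀.le hρ₁.le]

theorem one_le_constC (hρ₀ : 0 < ρ) (hρ₁ : ρ < 1) (hρ : rhoBar ρ < 1) : 1 ≤ constC ρ := by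
  have hL := one_le_log_exp_one_div hρ₀ hρ₁
  have : 0 ≤ rhoBar ρ := by unfold rhoBar; positivity
  rw [constC, le_div_iff₀ (by linarith)]
  linarith

theorem four_mul_le_constD (hρ₀ : 0 < ρ) (hρ₁ : ρ < 1) (hρ : rhoBar ρ < 1) :
    4 * ρ ≤ constD ρ := by
  have hL := one_le_log_exp_one_div hρ₀ hρ₁
  have hC := one_le_constC hρ₀ hρ₁ hρ
  have : 1 ≤ constC ρ * Real.log (Real.exp 1 / ρ) := one_le_mul_of_one_le_of_one_le hC hL
  rw [constD, mul_assoc]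
  nlinarith

/-- The equation that determines the radius `C_ρ ε₀ + D_ρ δ`. -/
theorem radius_mul_one_sub (hρ : rhoBar ρ < 1) (ε₀ δ : ℝ) :
    (constC ρ * ε₀ + constD ρ * δ) * (1 - ρ)
      = ε₀ + ρ * Real.log (Real.exp 1 / ρ) * (2 * (constC ρ * ε₀ + constD ρ * δ) + 4 * δ) := by
  have h : constC ρ * (1 - rhoBar ρ) = 1 := by
    rw [constC]; exact one_div_mul_cancel (by linarith)
  rw [constD]
  rw [rhoBar] at h
  linear_combination (ε₀ + 4 * ρ * Real.log (Real.exp 1 / ρ) * δ) * h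

theorem floor_mul_le (M : ℕ) (hρ₀ : 0 < ρ) (hρ₁ : ρ < 1) : ⌊ρ * M⌋₊ ≤ M := by
  have : (⌊ρ * M⌋₊ : ℝ) ≤ M := (Nat.floor_le (by positivity)).trans
    (mul_le_of_le_one_left (Nat.cast_nonneg _) hρ₁.le)
  exact_mod_cast this

/-- The exponents of the three factors are balanced here. At least `(1 - ρ) M` rows are consistent,
and only one of the two copies of `ρ M log (e/ρ)` in the hypothesis is needed. -/
theorem choose_mul_sq_mul_exp_pow_le {M n : ℕ} {σ B η : ℝ} (hρ₀ : 0 < ρ) (hρ₁ : ρ < 1)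
    (hσ : 0 ≤ σ)
    (hM : 2 * (ρ * M * Real.log (Real.exp 1 / ρ)) + 2 * B ≤ σ * (1 - ρ) * M)
    (hn : (n : ℝ) ^ 2 / 2 ≤ η * Real.exp (2 * B)) :
    (M.choose ⌊ρ * M⌋₊ : ℝ) * ((n : ℝ) ^ 2 / 2) * Real.exp (-σ) ^ (M - ⌊ρ * M⌋₊) ≤ η := by
  have hL := one_le_log_exp_one_div hρ₀ hρ₁
  set L := Real.log (Real.exp 1 / ρ)
  have hR : (⌊ρ * M⌋₊ : ℝ) ≤ ρ * M := Nat.floor_le (by positivity)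
  have hRM := floor_mul_le M hρ₀ hρ₁
  have h1 := choose_le_exp_mul_log hρ₀ hρ₁.le hR
  have h2 : Real.exp (-σ) ^ (M - ⌊ρ * M⌋₊) ≤ Real.exp (-(σ * (1 - ρ) * M)) := by
    rw [← Real.exp_nat_mul, Nat.cast_sub hRM]
    refine Real.exp_le_exp.2 ?_
    nlinarith
  have hη : 0 ≤ η := by
    by_contra! h
    have := mul_neg_of_neg_of_pos h (Real.exp_pos (2 * B))
    nlinarith [sq_nonneg (n : ℝ)]
  calc _ ≤ Real.exp (ρ * M * L) * (η * Real.exp (2 * B)) * Real.exp (-(σ * (1 - ρ) * M)) := by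
        gcongr
    _ = η * Real.exp (ρ * M * L + 2 * B - σ * (1 - ρ) * M) := by
        rw [sub_eq_add_neg (_ + _), Real.exp_add, Real.exp_add]; ring
    _ ≤ η * 1 := by
        refine mul_le_mul_of_nonneg_left (Real.exp_le_one_iff.2 ?_) hη
        have : 0 ≤ ρ * M * L := by positivity
        linarith
    _ = η := mul_one η

end Constants

/-! ### Measurement budgets and the two cases -/

section MainTheorem

variable {M N : ℕ} {δ ε₀ η ρ : ℝ}

theorem exp_two_mul_log_budget {D : ℕ} {X : ℝ} (hX : 0 < X) (hη₀ : 0 < η) :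
    η * Real.exp (2 * (D * Real.log X + Real.log (1 / (2 * η)))) = X ^ (2 * D) / (4 * η) := by
  have e : 2 * (D * Real.log X + Real.log (1 / (2 * η)))
      = (2 * D : ℕ) * Real.log X + (2 : ℕ) * Real.log (1 / (2 * η)) := by push_cast; ring
  rw [e, Real.exp_add, Real.exp_nat_mul, Real.exp_nat_mul, Real.exp_log hX,
    Real.exp_log (by positivity)]
  field_simp
  norm_num

/-- Since `η < 1`, the possibly negative term is at least `-log 2`, which `log X` compensates.
Nonnegativity is needed to lower the prefactor of a budget. -/
theorem log_budget_nonneg {D : ℕ} {X : ℝ} (hD : 1 ≤ D) (hX : 2 ≤ X) (hη₀ : 0 < η) (hη₁ : η < 1) :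
    0 ≤ D * Real.log X + Real.log (1 / (2 * η)) := by
  have h1 : Real.log 2 ≤ Real.log X := Real.log_le_log two_pos hX
  have h2 : -Real.log 2 ≤ Real.log (1 / (2 * η)) := by
    rw [← Real.log_inv]
    refine Real.log_le_log (by norm_num) ?_
    rw [inv_eq_one_div]
    gcongr
    linarith
  have h3 : (1 : ℝ) ≤ D := by exact_mod_cast hD
  have h4 : 0 ≤ Real.log 2 := Real.log_nonneg one_le_two
  nlinarith

/-- Scaling down the radius in the logarithm of a budget makes it smaller. -/
theorem budget_mul_le {D : ℕ} {a ε κ κ' m : ℝ} (hD : 1 ≤ D) (ha : 0 < a) (hε₀ : 0 < ε₀)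
    (hε : ε₀ ≤ ε) (haε : 2 ≤ a / ε) (hκ : κ' ≤ κ) (hη₀ : 0 < η) (hη₁ : η < 1) (hκ' : 0 ≤ κ')
    (h : κ / ε₀ * (D * Real.log (a / ε₀) + Real.log (1 / (2 * η))) ≤ m) :
    κ' * (D * Real.log (a / ε) + Real.log (1 / (2 * η))) ≤ m * ε₀ := by
  have h1 : Real.log (a / ε) ≤ Real.log (a / ε₀) :=
    Real.log_le_log (by positivity) (by gcongr)
  have h2 := log_budget_nonneg hD haε hη₀ hη₁
  have h3 : D * Real.log (a / ε) + Real.log (1 / (2 * η))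
      ≤ D * Real.log (a / ε₀) + Real.log (1 / (2 * η)) := by gcongr
  rw [div_mul_eq_mul_div, div_le_iff₀ hε₀] at h
  refine le_trans ?_ h
  exact mul_le_mul hκ h3 h2 (hκ'.trans hκ)

theorem holdsWithProbAtLeast_of_forall {Ω : Type*} [MeasurableSpace Ω] (P : Measure Ω)
    [IsProbabilityMeasure P] (hη₀ : 0 < η) {good : Ω → Prop} (h : ∀ ω, good ω) :
    HoldsWithProbAtLeast P (1 - η) good := by
  refine ⟨Set.univ, MeasurableSet.univ, ?_, fun ω _ => h ω⟩
  rw [measure_univ, ENNReal.ofReal_le_one]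
  linarith

theorem proximityOn_of_two_le_radius {S : Set (EuclideanSpace ℝ (Fin N))}
    (hS : S ⊆ unitBall N) (h : 2 ≤ constC ρ * ε₀ + constD ρ * δ) (Φ : Fin M → Fin N → ℝ)
    (ξ : Fin M → ℝ) : ProximityOn δ ε₀ ρ S Φ ξ := fun x hx y hy _ => by
  have h1 : ‖x‖ ≤ 1 := hS hx
  have h2 : ‖y‖ ≤ 1 := hS hy
  linarith [norm_sub_le x y]

/-- A net of the unit ball fine enough for the coarse row estimate and small enough for the
measurement budget. -/
theorem exists_net_unitBall_of_radius (hN : 1 ≤ N) {ε : ℝ} (hε : 0 < ε) (hε₂ : ε ≤ 2) :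
    ∃ (r : ℝ) (n : ℕ) (p : Fin n → EuclideanSpace ℝ (Fin N)), 0 ≤ r ∧
      2 * r ≤ 1245 / 10000 * ε ∧ 2 * r * √(N : ℝ) ≤ 176 / 1000 * ε ∧
      2 * (n : ℝ) ^ 2 ≤ (29 * √(N : ℝ) / ε) ^ (2 * N) ∧
      ∀ x ∈ unitBall N, ∃ i, ‖x - p i‖ ≤ r := by
  -- For `N ≥ 2` the factor `2` in `2n²` is absorbed by a ratio of constants raised to the power
  -- `2N`; for `N = 1` that power is too small, and the net of the line is used.
  obtain rfl | hN2 : N = 1 ∨ 2 ≤ N := by omega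
  · obtain ⟨n, p, hn, hp⟩ := exists_net_unitBall_fin_one (r := 6 / 100 * ε) (by positivity)
    refine ⟨6 / 100 * ε, n, p, by positivity, by linarith, ?_, ?_, hp⟩
    · simp; linarith
    · have h1 : (n : ℝ) ≤ (56 / 3) / ε := by
        refine hn.trans ?_
        rw [le_div_iff₀ hε]
        field_simp
        linarith
      have h2 : (n : ℝ) ^ 2 ≤ ((56 / 3) / ε) ^ 2 := by gcongr
      simp only [Nat.cast_one, Real.sqrt_one, mul_one]
      rw [div_pow] at h2 ⊢
      calc 2 * (n : ℝ) ^ 2 ≤ 2 * ((56 / 3) ^ 2 / ε ^ 2) := by linarith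
        _ = (2 * (56 / 3) ^ 2) / ε ^ 2 := by ring
        _ ≤ _ := by gcongr; norm_num
  · have hN2' : (2 : ℝ) ≤ N := by exact_mod_cast hN2
    have hs : 14140 / 10000 ≤ √(N : ℝ) := Real.le_sqrt_of_sq_le (by norm_num; linarith)
    set s := √(N : ℝ)
    have hs0 : 0 < s := by linarith
    -- This `r` makes `2r√N = 0.176 ε` exactly; then `√N ≥ 1.414` yields `2r ≤ 0.1245 ε`.
    obtain ⟨n, p, hn, hp⟩ := exists_net_unitBall (EuclideanSpace ℝ (Fin N))
      (r := 11 / 125 * ε / s) (by positivity)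
    rw [finrank_euclideanSpace, Fintype.card_fin] at hn
    refine ⟨11 / 125 * ε / s, n, p, by positivity, ?_, ?_, ?_, hp⟩
    · rw [← mul_div_assoc, div_le_iff₀ hs0]
      nlinarith
    · rw [mul_assoc, div_mul_cancel₀ _ hs0.ne']; linarith
    · have h1 : 1 + 2 / (11 / 125 * ε / s) ≤ 24145 / 1000 * (s / ε) := by
        have e1 : 2 / (11 / 125 * ε / s) = 250 / 11 * (s / ε) := by field_simp; norm_num
        have e2 : 707 / 1000 ≤ s / ε := by rw [le_div_iff₀ hε]; linarith
        rw [e1]; linarith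
      have h2 : (n : ℝ) ≤ (24145 / 1000 * (s / ε)) ^ N :=
        hn.trans (pow_le_pow_left₀ (by positivity) h1 N)
      have h3 : (2 : ℝ) ≤ ((29 / (24145 / 1000)) ^ 2) ^ N :=
        le_trans (by norm_num : (2 : ℝ) ≤ ((29 / (24145 / 1000)) ^ 2) ^ 2)
          (pow_le_pow_right₀ (by norm_num) hN2)
      calc 2 * (n : ℝ) ^ 2
          ≤ ((29 / (24145 / 1000)) ^ 2) ^ N * ((24145 / 1000 * (s / ε)) ^ N) ^ 2 := by gcongr
        _ = (29 / (24145 / 1000) * (24145 / 1000 * (s / ε))) ^ (2 * N) := by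
            rw [← pow_mul, ← pow_mul, mul_comm N 2, ← mul_pow]
        _ = _ := by congr 1; ring

theorem holdsWithProbAtLeast_unitBall (hN : 1 ≤ N) (hδ : 0 < δ) (hε₀ : 0 < ε₀) (hη₀ : 0 < η)
    (hη₁ : η < 1) (hρ₀ : 0 < ρ) (hρ₁ : ρ < 1) (hρ : rhoBar ρ < 1)
    (hM : (4 * δ + 4) / ε₀ * ((N : ℝ) * Real.log (29 * √(N : ℝ) / ε₀) + Real.log (1 / (2 * η)))
      ≤ (M : ℝ)) :
    HoldsWithProbAtLeast (sensingLaw M N δ) (1 - η)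
      (fun ω => ProximityOn δ ε₀ ρ (unitBall N) ω.1 ω.2) := by
  have := isProbabilityMeasure_sensingLaw M N hδ
  rcases le_or_gt 2 (constC ρ * ε₀ + constD ρ * δ) with hbig | hsmall
  · exact holdsWithProbAtLeast_of_forall _ hη₀ fun ω =>
      proximityOn_of_two_le_radius subset_rfl hbig _ _
  have hrad := radius_mul_one_sub hρ ε₀ δ
  have hε₀ε : ε₀ ≤ constC ρ * ε₀ + constD ρ * δ := by
    have h1 := one_le_constC hρ₀ hρ₁ hρ
    have h2 := four_mul_le_constD hρ₀ hρ₁ hρ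
    have h3 : 0 ≤ constD ρ * δ := mul_nonneg (by linarith) hδ.le
    nlinarith
  set ε := constC ρ * ε₀ + constD ρ * δ with hε_def
  have hε : 0 < ε := by linarith
  have hs : 1 ≤ √(N : ℝ) := Real.one_le_sqrt.2 (by exact_mod_cast hN)
  obtain ⟨r, n, p, hr, hr₁, hrN, hn, hp⟩ := exists_net_unitBall_of_radius hN hε hsmall.le
  have haε : 2 ≤ 29 * √(N : ℝ) / ε := by rw [le_div_iff₀ hε]; linarith
  -- `4δ + 2ε` is twice the denominator of the rate `ε/(2δ+ε)`, and `ε < 2` bounds it by `4δ + 4`.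
  have hB := budget_mul_le (κ' := 4 * δ + 2 * ε) hN (by positivity) hε₀ hε₀ε haε (by linarith)
    hη₀ hη₁ (by positivity) hM
  set B := (N : ℝ) * Real.log (29 * √(N : ℝ) / ε) + Real.log (1 / (2 * η)) with hB_def
  refine holdsWithProbAtLeast_of_net (n := n) (r := r) (ε := ε) (p := p)
    (S := fun _ => Finset.univ) (b := Real.exp (-(ε / (2 * δ + ε)))) hδ (Real.exp_pos _).le hη₀.le
    (by linarith) (fun x hx => ?_) (fun i j hij => ?_)
    (choose_mul_sq_mul_exp_pow_le (B := B) hρ₀ hρ₁ (by positivity) ?_ ?_) (floor_mul_le M hρ₀ hρ₁)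
  · obtain ⟨i, hi⟩ := hp x hx
    exact ⟨i, hi, fun j hj => absurd (Finset.mem_univ j) hj⟩
  · exact measure_ambiguousRows_le_exp_coarse hδ hε hr (by simp) (by simp) hr₁ hrN hij
  -- After clearing `2δ + ε`, the equation for the radius cancels the binomial cost exactly and
  -- leaves `(4δ + 2ε) B ≤ M ε₀`.
  · rw [div_mul_eq_mul_div, hrad, div_mul_eq_mul_div, le_div_iff₀ (by positivity)]
    linarith
  · rw [hB_def, exp_two_mul_log_budget (by linarith) hη₀, le_div_iff₀ (by positivity)]
    nlinarith [sq_nonneg (n : ℝ)]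

/-- A net of the sparse vectors of the unit ball fine enough for the fine row estimate and small
enough for the measurement budget. -/
theorem exists_net_sparseVectors_of_radius {K : ℕ} (hK : 1 ≤ K) (hKN : K ≤ N) {ε : ℝ}
    (hε : 0 < ε) (hε₂ : ε ≤ 2) :
    ∃ (n : ℕ) (p : Fin n → EuclideanSpace ℝ (Fin N)) (S : Fin n → Finset (Fin N)),
      (∀ i, (S i).card ≤ K) ∧
      2 * (n : ℝ) ^ 2 ≤ (56 * (N / √(K : ℝ)) / ε) ^ (2 * (2 * K)) ∧
      ∀ x ∈ sparseVectors N K ∩ unitBall N,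
        ∃ i, ‖x - p i‖ ≤ ε / (100 * √(K : ℝ)) ∧ ∀ j ∉ S i, x j = p i j := by
  have hK' : (1 : ℝ) ≤ K := by exact_mod_cast hK
  have hKN' : (K : ℝ) ≤ N := by exact_mod_cast hKN
  have hs : 1 ≤ √(K : ℝ) := Real.one_le_sqrt.2 hK'
  have hsq : √(K : ℝ) ^ 2 = K := Real.sq_sqrt (by positivity)
  set s := √(K : ℝ)
  have hs0 : 0 < s := by linarith
  have hsN : s ≤ N := by nlinarith
  obtain ⟨n, p, S, hn, hS, hp⟩ := exists_net_sparseVectors hK hKN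
    (r := ε / (100 * s)) (by positivity)
  refine ⟨n, p, S, hS, ?_, hp⟩
  set V := N / s / ε with hV_def
  have hV : 1 / 2 ≤ V := by
    rw [hV_def, le_div_iff₀ hε, le_div_iff₀ hs0]; nlinarith
  have hV0 : 0 < V := by linarith
  have h1 : Real.exp 1 * N / K * (1 + 2 / (ε / (100 * s))) ≤ 550 * V := by
    have e1 : 2 / (ε / (100 * s)) = 200 * (s / ε) := by field_simp; norm_num
    have e2 : 1 / 2 ≤ s / ε := by rw [le_div_iff₀ hε]; linarith
    calc _ ≤ 2.7182818286 * N / K * (202 * (s / ε)) := by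
          rw [e1]
          gcongr
          · exact Real.exp_one_lt_d9.le
          · linarith
      _ = 2.7182818286 * 202 * V := by
          rw [hV_def, ← hsq]; field_simp
      _ ≤ 550 * V := mul_le_mul_of_nonneg_right (by norm_num) hV0.le
  have h2 : (n : ℝ) ≤ (550 * V) ^ K :=
    hn.trans (pow_le_pow_left₀ (by positivity) h1 K)
  -- The budget has exponent `4K` while the squared net size has only `2K`; the spare factor `V² ≥
  -- 1/4` absorbs the constants.
  have h4 : 2 * (550 * V) ^ 2 ≤ (56 * V) ^ 4 := by
    have : 1 / 4 ≤ V ^ 2 := by nlinarith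
    nlinarith [sq_nonneg V]
  have h5 : (2 : ℝ) ≤ 2 ^ K := le_self_pow₀ one_le_two (by omega)
  calc 2 * (n : ℝ) ^ 2 ≤ 2 ^ K * ((550 * V) ^ K) ^ 2 := by gcongr
    _ = (2 * (550 * V) ^ 2) ^ K := by
        rw [mul_pow 2 ((550 * V) ^ 2), ← pow_mul, ← pow_mul, mul_comm K 2]
    _ ≤ ((56 * V) ^ 4) ^ K := by gcongr
    _ = _ := by rw [← pow_mul, hV_def, mul_div_assoc]; congr 1; ring

theorem holdsWithProbAtLeast_sparseVectors {K : ℕ} (hK : 1 ≤ K) (hKN : K ≤ N) (hδ : 0 < δ)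
    (hε₀ : 0 < ε₀) (hη₀ : 0 < η) (hη₁ : η < 1) (hρ₀ : 0 < ρ) (hρ₁ : ρ < 1) (hρ : rhoBar ρ < 1)
    (hM : (4 * δ + 2) / ε₀ *
        (2 * (K : ℝ) * Real.log (56 * (N : ℝ) / (√(K : ℝ) * ε₀)) + Real.log (1 / (2 * η)))
      ≤ (M : ℝ)) :
    HoldsWithProbAtLeast (sensingLaw M N δ) (1 - η)
      (fun ω => ProximityOn δ ε₀ ρ (sparseVectors N K ∩ unitBall N) ω.1 ω.2) := by
  have := isProbabilityMeasure_sensingLaw M N hδ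
  rcases le_or_gt 2 (constC ρ * ε₀ + constD ρ * δ) with hbig | hsmall
  · exact holdsWithProbAtLeast_of_forall _ hη₀ fun ω =>
      proximityOn_of_two_le_radius Set.inter_subset_right hbig _ _
  have hrad := radius_mul_one_sub hρ ε₀ δ
  have hε₀ε : ε₀ ≤ constC ρ * ε₀ + constD ρ * δ := by
    have h1 := one_le_constC hρ₀ hρ₁ hρ
    have h2 := four_mul_le_constD hρ₀ hρ₁ hρ
    have h3 : 0 ≤ constD ρ * δ := mul_nonneg (by linarith) hδ.le
    nlinarith
  have hL := one_le_log_exp_one_div hρ₀ hρ₁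
  set L := Real.log (Real.exp 1 / ρ)
  set ε := constC ρ * ε₀ + constD ρ * δ with hε_def
  have hε : 0 < ε := by linarith
  have hK' : (1 : ℝ) ≤ K := by exact_mod_cast hK
  have hKN' : (K : ℝ) ≤ N := by exact_mod_cast hKN
  have hs : 1 ≤ √(K : ℝ) := Real.one_le_sqrt.2 hK'
  have hsq : √(K : ℝ) ^ 2 = K := Real.sq_sqrt (by positivity)
  set s := √(K : ℝ)
  have hs0 : 0 < s := by linarith
  have hsN : s ≤ N := by nlinarith
  have hN0 : (0 : ℝ) < N := by linarith
  obtain ⟨n, p, S, hS, hn, hp⟩ := exists_net_sparseVectors_of_radius hK hKN hε hsmall.le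
  have hV : 1 / 2 ≤ N / s / ε := by
    rw [le_div_iff₀ hε, le_div_iff₀ hs0]; nlinarith
  have haε : 2 ≤ 56 * (N / s) / ε := by rw [mul_div_assoc]; linarith
  have hM' : (4 * δ + 2) / ε₀ *
      ((2 * K : ℕ) * Real.log (56 * (N / s) / ε₀) + Real.log (1 / (2 * η))) ≤ (M : ℝ) := by
    convert! hM using 3
    push_cast
    congr 2
    field_simp
  have hB := budget_mul_le (κ' := 4 * δ + ε) (D := 2 * K) (by omega) (by positivity) hε₀ hε₀ε haε
    (by linarith) hη₀ hη₁ (by positivity) hM'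
  set B := ((2 * K : ℕ) : ℝ) * Real.log (56 * (N / s) / ε) + Real.log (1 / (2 * η)) with hB_def
  refine holdsWithProbAtLeast_of_net (n := n) (r := ε / (100 * s)) (ε := ε) (p := p)
    (S := S) (b := Real.exp (-(2 * ε / (4 * δ + ε)))) hδ (Real.exp_pos _).le hη₀.le
    ?_ hp (fun i j hij => ?_)
    (choose_mul_sq_mul_exp_pow_le (B := B) hρ₀ hρ₁ (by positivity) ?_ ?_) (floor_mul_le M hρ₀ hρ₁)
  · rw [← mul_div_assoc, div_le_iff₀ (by positivity)]
    nlinarith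
  · refine measure_ambiguousRows_le_exp_fine hδ hε (by positivity) (hS i) (hS j) ?_ ?_ hij
    · rw [← mul_div_assoc, div_le_iff₀ (by positivity)]
      nlinarith
    · refine le_of_eq ?_
      change 2 * (ε / (100 * s)) * s = _
      field_simp
  · have e : 2 * ε * (1 - ρ) = 2 * (ε₀ + ρ * L * (2 * ε + 4 * δ)) := by rw [mul_assoc, hrad]
    rw [div_mul_eq_mul_div, e, div_mul_eq_mul_div, le_div_iff₀ (by positivity)]
    -- With the rate `2ε/(4δ+ε)` the binomial cost is more than cancelled; this nonnegative term is
    -- part of the surplus.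
    have h1 : 0 ≤ ρ * M * L * ε := by positivity
    linarith
  · rw [hB_def, exp_two_mul_log_budget (by linarith) hη₀, le_div_iff₀ (by positivity)]
    nlinarith [sq_nonneg (n : ℝ)]

end MainTheorem

theorem theorem4 (M N : ℕ) (hN : 1 ≤ N) (δ ε₀ η ρ : ℝ) (hδ : 0 < δ) (hε₀ : 0 < ε₀)
    (hη₀ : 0 < η) (hη₁ : η < 1) (hρ₀ : 0 < ρ) (hρ₁ : ρ < 1) (hρ : rhoBar ρ < 1) :
    (1 ≤ constC ρ ∧ 4 * ρ ≤ constD ρ) ∧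
    ((4 * δ + 4) / ε₀ * ((N : ℝ) * Real.log (29 * √(N : ℝ) / ε₀) + Real.log (1 / (2 * η)))
        ≤ (M : ℝ) →
      HoldsWithProbAtLeast (sensingLaw M N δ) (1 - η)
        (fun ω => ProximityOn δ ε₀ ρ (unitBall N) ω.1 ω.2)) ∧
    (∀ K : ℕ, 1 ≤ K → K ≤ N →
      (4 * δ + 2) / ε₀ *
          (2 * (K : ℝ) * Real.log (56 * (N : ℝ) / (√(K : ℝ) * ε₀)) + Real.log (1 / (2 * η)))
        ≤ (M : ℝ) →
      HoldsWithProbAtLeast (sensingLaw M N δ) (1 - η)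
        (fun ω => ProximityOn δ ε₀ ρ (sparseVectors N K ∩ unitBall N) ω.1 ω.2)) :=
  ⟨⟨one_le_constC hρ₀ hρ₁ hρ, four_mul_le_constD hρ₀ hρ₁ hρ⟩,
    holdsWithProbAtLeast_unitBall hN hδ hε₀ hη₀ hη₁ hρ₀ hρ₁ hρ,
    fun _ hK hKN => holdsWithProbAtLeast_sparseVectors hK hKN hδ hε₀ hη₀ hη₁ hρ₀ hρ₁ hρ⟩
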